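/- All graphs are finite and undirected, and parallel edges are allowed. Let $c(G)$ denote the number of connected components of $G$. For real $t$, a graph $G$ is $t$-tough if $|S|\ge t\cdot c(G-S)$ for every $S\subseteq V(G)$ with $c(G-S)>1$; the toughness $\tau(G)$ is the largest $t$ for which $G$ is $t$-tough, with $\tau(G)=\infty$ if $G$ is $t$-tough for every $t$ (for instance if $G$ is complete). The graph $G$ is minimally $t$-tough if $\tau(G)=t$ and $\tau(G-e)<t$ for every edge $e\in E(G)$. A series–parallel graph $G(s,t)$ with terminals $s\neq t$ is either a single edge connecting $s$ and $t$, or it is obtained from series–parallel graphs $G_1(s_1,t_1),\dots,G_k(s_k,t_k)$, $k\ge 2$, by a series join (identify $t_i$ with $s_{i+1}$ for $1\le i\le k-1$, and put $s=s_1$, $t=t_k$) or by a parallel join (identify all $s_i$ to a single vertex $s$ and all $t_i$ to a single vertex $t$). A pearl is the parallel join of two paths, each of length at least $2$, where the terminals of a path are its two end vertices. Theorem. A series–parallel graph $G(s,t)$ is minimally $\tfrac12$-tough if and only if it is a series join of pearls (any number of them, possibly none) and at least two single edges, in some order, in which the first and the last component are single edges. -/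

import Mathlib

open scoped Graph

/-! ### Toughness of a multigraph -/

namespace Graph

variable {α β : Type*}

/-- The number `c(G)` of connected components of a (finite) multigraph. Loops and multiplicities of
edges play no role here, so we count the components of the underlying simple graph. -/
noncomputable def numComponents (G : Graph α β) : ℕ :=
  Nat.card G.toSimpleGraph.ConnectedComponent

/-- `G` is `t`-tough: `|S| ≥ t * c(G - S)` for every `S ⊆ V(G)` with `c(G - S) > 1`. -/
def IsTough (G : Graph α β) (t : ℝ) : Prop :=
  ∀ S : Set α, S ⊆ V(G) → 1 < (G.deleteVerts S).numComponents →
    t * ((G.deleteVerts S).numComponents : ℝ) ≤ (S.ncard : ℝ)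

/-- The toughness `τ(G)`: the largest `t` such that `G` is `t`-tough. It is `⊤` when `G` is
`t`-tough for every `t`, that is, when any two vertices of `G` are adjacent. -/
noncomputable def toughness (G : Graph α β) : EReal :=
  sSup ((fun t : ℝ => (t : EReal)) '' {t : ℝ | G.IsTough t})

/-- `G` is minimally `t`-tough: `τ(G) = t`, and `τ(G - e) < t` for every edge `e` of `G`. -/
def IsMinimallyTough (G : Graph α β) (t : ℝ) : Prop :=
  G.toughness = (t : EReal) ∧ ∀ e ∈ E(G), (G.deleteEdges {e}).toughness < (t : EReal)

end Graph

/-! ### Graphs with two terminals and their joins -/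

/-- A multigraph `G(s, t)` together with two terminals, `source = s` and `target = t`. -/
structure TwoTerminalGraph (α β : Type*) where
  graph : Graph α β
  source : α
  target : α

namespace TwoTerminalGraph

variable {α β : Type*}

/-- `G` consists of one edge connecting its two distinct terminals. -/
def IsSingleEdge (G : TwoTerminalGraph α β) : Prop :=
  G.source ≠ G.target ∧ ∃ e : β, G.graph = Graph.banana G.source G.target {e}

/-- `G` is the union of the edge-disjoint multigraphs `A` and `B`. -/
def IsEdgeDisjointUnion (A B G : Graph α β) : Prop :=
  Disjoint E(A) E(B) ∧ V(G) = V(A) ∪ V(B) ∧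
    ∀ e x y, G.IsLink e x y ↔ A.IsLink e x y ∨ B.IsLink e x y

/-- `G` is the series join of `A` and `B`: the target of `A` is identified with the source of `B`,
and this is the only vertex which `A` and `B` share. -/
def IsSeriesJoin₂ (A B G : TwoTerminalGraph α β) : Prop :=
  G.source = A.source ∧ A.target = B.source ∧ G.target = B.target ∧
    V(A.graph) ∩ V(B.graph) = {A.target} ∧ IsEdgeDisjointUnion A.graph B.graph G.graph

/-- `G` is the parallel join of `A` and `B`: the two sources are identified, the two targets are
identified, and these are the only vertices which `A` and `B` share. -/
def IsParallelJoin₂ (A B G : TwoTerminalGraph α β) : Prop :=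
  A.source = G.source ∧ B.source = G.source ∧ A.target = G.target ∧ B.target = G.target ∧
    V(A.graph) ∩ V(B.graph) = {G.source, G.target} ∧ IsEdgeDisjointUnion A.graph B.graph G.graph

/-- Series-parallel graphs: built from single edges by series and parallel joins. (A join of more
than two graphs is obtained by joining two graphs at a time.) -/
inductive IsSeriesParallel : TwoTerminalGraph α β → Prop
  | edge {G : TwoTerminalGraph α β} : G.IsSingleEdge → IsSeriesParallel G
  | series {A B G : TwoTerminalGraph α β} :
      IsSeriesParallel A → IsSeriesParallel B → IsSeriesJoin₂ A B G → IsSeriesParallel G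
  | parallel {A B G : TwoTerminalGraph α β} :
      IsSeriesParallel A → IsSeriesParallel B → IsParallelJoin₂ A B G → IsSeriesParallel G

/-- `IsSeriesJoin [G₁, …, Gₖ] G`: `G` is the series join of `G₁, …, Gₖ`, in this order. -/
inductive IsSeriesJoin : List (TwoTerminalGraph α β) → TwoTerminalGraph α β → Prop
  | single (G : TwoTerminalGraph α β) : IsSeriesJoin [G] G
  | cons {A H G : TwoTerminalGraph α β} {L : List (TwoTerminalGraph α β)} :
      IsSeriesJoin L H → IsSeriesJoin₂ A H G → IsSeriesJoin (A :: L) G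

/-- `G` is a path with `n` edges whose two end vertices are the terminals. -/
def IsPathOfLength (G : TwoTerminalGraph α β) (n : ℕ) : Prop :=
  ∃ L : List (TwoTerminalGraph α β),
    L.length = n ∧ (∀ X ∈ L, X.IsSingleEdge) ∧ IsSeriesJoin L G

/-- A pearl: the parallel join of two paths, each of length at least 2. -/
def IsPearl (G : TwoTerminalGraph α β) : Prop :=
  ∃ (P Q : TwoTerminalGraph α β) (m n : ℕ), 2 ≤ m ∧ 2 ≤ n ∧
    P.IsPathOfLength m ∧ Q.IsPathOfLength n ∧ IsParallelJoin₂ P Q G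

end TwoTerminalGraph

/-!
Both directions rest on a calculus for two-terminal graphs. For a two-terminal graph `H` and a set
`S`, the *surplus* of `S` is the number of components of `H - S` without terminals, minus twice the
number of inner vertices in `S`. Under a parallel join the surplus is additive; under a series join
it is additive up to a correction `-2`, `0` or `1`, which depends on whether the middle vertex is
in `S` and whether it is cut off from both terminals (`IsParallelJoin₂.surplus`,
`IsSeriesJoin₂.surplus`). The number of components of `H - S` minus `2 |S|` is the surplus plus a
constant that depends only on which terminals lie in `S` and whether they are linked in `H - S`, so
toughness `1/2` and the criticality of edges become inequalities between surpluses.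

For the necessity of the structure, every part `X` of the series-parallel graph `G` is viewed
together with its context: `G` is the parallel join of `X` with a graph `K`, and contexts of parts
of `X` are again obtained by series and parallel joins (`IsSeriesJoin₂.exists_context`,
`IsParallelJoin₂.assoc`). If `X` is a parallel join of small parts (`IsSmall`), then a set that
shows an edge at the source of `X` to be critical must contain the target and not the source, and
must have positive surplus on `K`; likewise at the target (`IsParallelJoin₂.isViolation_source`).
Two such sets on `K` can be uncrossed (`Uncrosses`) to a set of surplus `2` that contains both
terminals, and toughness then shows that `X` is small. By induction, in contexts that connect their
terminals, every part is small, and it is a path or *fat* (`IsSeriesParallel.isSmall_and`); a fat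
part has a set of surplus `2` containing both terminals.

Finally `G` is cut at its cut vertices. A block that is a parallel join has surplus at most `2`,
and each of its two sides has surplus at least `1`; so no side is fat, both are paths, and the
block is a pearl. The positive surplus on both sides of its context shows that it is neither the
first nor the last block (`IsParallelJoin₂.isPearl`, `IsSeriesParallel.exists_isSeriesJoin`).

Conversely, edges and pearls are small, smallness is inherited by series joins, and it implies
`1/2`-toughness. An edge of a pearl is critical because deleting it and one terminal of the pearl
leaves three components (`IsPearl.one_le_surplus_deleteEdge`,
`IsSeriesJoin.cutsInside_or_cutsAtSource`).
-/

namespace Graph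

variable {α β : Type*}

/-! ### Components of unions -/

/-- `y` can be reached from the vertex `x` along edges of `H`. -/
def Reach (H : Graph α β) (x y : α) : Prop := x ∈ V(H) ∧ Relation.ReflTransGen H.Adj x y

lemma Reach.refl {H : Graph α β} {x : α} (hx : x ∈ V(H)) : H.Reach x x := ⟨hx, .refl⟩

lemma Reach.left_mem {H : Graph α β} {x y : α} (h : H.Reach x y) : x ∈ V(H) := h.1

lemma Reach.right_mem {H : Graph α β} {x y : α} (h : H.Reach x y) : y ∈ V(H) := by
  obtain ⟨hx, h⟩ := h
  cases h with
  | refl => exact hx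
  | tail _ h => exact h.right_mem

lemma Reach.symm {H : Graph α β} {x y : α} (h : H.Reach x y) : H.Reach y x :=
  ⟨h.right_mem, by
    have : Std.Symm H.Adj := ⟨fun _ _ => Adj.symm⟩
    exact Relation.ReflTransGen.stdSymm.symm _ _ h.2⟩

lemma Reach.trans {H : Graph α β} {x y z : α} (h : H.Reach x y) (h' : H.Reach y z) :
    H.Reach x z := ⟨h.1, h.2.trans h'.2⟩

lemma Reach.tail {H : Graph α β} {x y z : α} (h : H.Reach x y) (h' : H.Adj y z) :
    H.Reach x z := ⟨h.1, h.2.tail h'⟩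

lemma Reach.mono {H K : Graph α β} (hV : V(H) ⊆ V(K)) (hA : ∀ x y, H.Adj x y → K.Adj x y)
    {x y : α} (h : H.Reach x y) : K.Reach x y := ⟨hV h.1, Relation.ReflTransGen.mono hA _ _ h.2⟩

lemma reach_comm {H : Graph α β} {x y : α} : H.Reach x y ↔ H.Reach y x := ⟨.symm, .symm⟩

/-- Vertex sets of the components of `H` which avoid the set `Z`. -/
def compsAvoiding (H : Graph α β) (Z : Set α) : Set (Set α) :=
  {C | (∃ x ∈ V(H), C = {y | H.Reach x y}) ∧ Disjoint C Z}

lemma finite_compsAvoiding {H : Graph α β} (hH : V(H).Finite) (Z : Set α) :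
    (H.compsAvoiding Z).Finite := by
  refine (hH.image fun x => {y | H.Reach x y}).subset ?_
  rintro C ⟨⟨x, hx, rfl⟩, -⟩
  exact ⟨x, hx, rfl⟩

lemma reach_of_toSimpleGraph {H : Graph α β} {x y : V(H)} (h : H.toSimpleGraph.Reachable x y) :
    H.Reach x y := by
  obtain ⟨w⟩ := h
  induction w with
  | nil => exact .refl (Subtype.coe_prop _)
  | cons h _ ih => exact Reach.trans (.tail (.refl (Subtype.coe_prop _)) h.2) ih

lemma toSimpleGraph_of_reach {H : Graph α β} {x y : α} (h : H.Reach x y) :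
    H.toSimpleGraph.Reachable ⟨x, h.left_mem⟩ ⟨y, h.right_mem⟩ := by
  obtain ⟨hx, h⟩ := h
  induction h with
  | refl => exact .refl _
  | @tail y z h h' ih =>
    by_cases hyz : y = z
    · subst hyz; exact ih
    · refine ih.trans (SimpleGraph.Adj.reachable ?_)
      exact ⟨by simpa using hyz, h'⟩

lemma numComponents_eq_ncard (H : Graph α β) :
    H.numComponents = (H.compsAvoiding ∅).ncard := by
  unfold numComponents
  rw [← Nat.card_coe_set_eq]
  refine Nat.card_congr (Equiv.ofBijective
    (fun c => c.lift (fun x : V(H) => (⟨{y | H.Reach x y}, ⟨x, x.2, rfl⟩, by simp⟩ :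
      H.compsAvoiding ∅)) ?_) ⟨?_, ?_⟩)
  · intro v w p _
    have h := reach_of_toSimpleGraph ⟨p⟩
    ext y
    exact ⟨fun hy => h.symm.trans hy, fun hy => h.trans hy⟩
  · intro c d
    induction c using SimpleGraph.ConnectedComponent.ind with | _ v
    induction d using SimpleGraph.ConnectedComponent.ind with | _ w
    intro h
    have h' : {y | H.Reach v y} = {y | H.Reach w y} := congrArg Subtype.val h
    have hw : H.Reach v w := by
      have : (w : α) ∈ {y | H.Reach w y} := Reach.refl w.2
      rwa [← h'] at this
    exact SimpleGraph.ConnectedComponent.sound (toSimpleGraph_of_reach hw)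
  · rintro ⟨C, ⟨x, hx, rfl⟩, _⟩
    exact ⟨H.toSimpleGraph.connectedComponentMk ⟨x, hx⟩, rfl⟩

open Classical in
/-- Enlarging the forbidden set `Z` by `m` excludes the component of `m`, if that avoids `Z`. -/
lemma ncard_compsAvoiding_insert {H : Graph α β} (hH : V(H).Finite) (Z : Set α) (m : α) :
    (H.compsAvoiding Z).ncard = (H.compsAvoiding (insert m Z)).ncard +
      if m ∈ V(H) ∧ ∀ z ∈ Z, ¬ H.Reach m z then 1 else 0 := by
  split_ifs with hm
  · have h : H.compsAvoiding Z = insert {y | H.Reach m y} (H.compsAvoiding (insert m Z)) := by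
      ext C
      constructor
      · rintro ⟨⟨x, hx, rfl⟩, hC⟩
        by_cases hxm : H.Reach x m
        · left
          ext y
          exact ⟨fun hy => hxm.symm.trans hy, fun hy => hxm.trans hy⟩
        · right
          exact ⟨⟨x, hx, rfl⟩, Set.disjoint_insert_right.2 ⟨hxm, hC⟩⟩
      · rintro (rfl | ⟨h, hC⟩)
        · exact ⟨⟨m, hm.1, rfl⟩, Set.disjoint_left.2 fun z hz hz' => hm.2 z hz' hz⟩
        · exact ⟨h, (Set.disjoint_insert_right.1 hC).2⟩
    rw [h, Set.ncard_insert_of_notMem _ (finite_compsAvoiding hH _)]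
    rintro ⟨-, h'⟩
    exact (Set.disjoint_insert_right.1 h').1 (Reach.refl hm.1)
  · rw [add_zero]
    congr 1
    ext C
    constructor
    · rintro ⟨⟨x, hx, rfl⟩, hC⟩
      refine ⟨⟨x, hx, rfl⟩, Set.disjoint_insert_right.2 ⟨fun hxm => hm ⟨hxm.right_mem, ?_⟩, hC⟩⟩
      exact fun z hz hmz => Set.disjoint_left.1 hC (hxm.trans hmz) hz
    · rintro ⟨h, hC⟩
      exact ⟨h, (Set.disjoint_insert_right.1 hC).2⟩

/-- `U` is the union of `A` and `B`, as far as adjacency is concerned. -/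
structure IsAdjUnion (A B U : Graph α β) : Prop where
  vertexSet : V(U) = V(A) ∪ V(B)
  adj : ∀ x y, U.Adj x y ↔ A.Adj x y ∨ B.Adj x y

namespace IsAdjUnion

variable {A B U : Graph α β}

lemma symm (h : IsAdjUnion A B U) : IsAdjUnion B A U :=
  ⟨by rw [h.vertexSet, Set.union_comm], fun x y => by rw [h.adj, or_comm]⟩

lemma reach_left (h : IsAdjUnion A B U) {x y : α} (hxy : A.Reach x y) : U.Reach x y :=
  hxy.mono (by rw [h.vertexSet]; exact Set.subset_union_left) fun x y hA => (h.adj x y).2 (.inl hA)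

lemma reach_right (h : IsAdjUnion A B U) {x y : α} (hxy : B.Reach x y) : U.Reach x y :=
  h.symm.reach_left hxy

lemma deleteVerts (h : IsAdjUnion A B U) (S : Set α) :
    IsAdjUnion (A.deleteVerts S) (B.deleteVerts S) (U.deleteVerts S) where
  vertexSet := by
    simp only [vertexSet_deleteVerts, h.vertexSet, Set.union_sdiff_distrib]
  adj x y := by
    have := h.adj x y
    simp only [Adj, deleteVerts_isLink, exists_and_right] at this ⊢
    tauto

/-- A component of `A` avoiding the common vertices is a component of the union. -/
lemma reach_iff_of_disjoint (h : IsAdjUnion A B U) {Z : Set α} (hZ : V(A) ∩ V(B) ⊆ Z) {x : α}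
    (hx : Disjoint {y | A.Reach x y} Z) (hxA : x ∈ V(A)) (y : α) : U.Reach x y ↔ A.Reach x y := by
  refine ⟨fun hy => ?_, h.reach_left⟩
  replace hy := hy.2
  induction hy with
  | refl => exact .refl hxA
  | @tail y z _ hyz ih =>
    rcases (h.adj y z).1 hyz with hA | hB
    · exact ih.tail hA
    · exact absurd (hZ ⟨ih.right_mem, hB.left_mem⟩) (Set.disjoint_left.1 hx ih)

lemma compsAvoiding_subset (h : IsAdjUnion A B U) {Z : Set α} (hZ : V(A) ∩ V(B) ⊆ Z) :
    A.compsAvoiding Z ⊆ U.compsAvoiding Z := by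
  rintro C ⟨⟨x, hx, rfl⟩, hC⟩
  refine ⟨⟨x, by rw [h.vertexSet]; exact .inl hx, ?_⟩, hC⟩
  ext y
  exact (h.reach_iff_of_disjoint hZ hC hx y).symm

/-- The components of a union that avoid the common vertices are those of the two parts. -/
lemma ncard_compsAvoiding (h : IsAdjUnion A B U) {Z : Set α} (hZ : V(A) ∩ V(B) ⊆ Z)
    (hA : V(A).Finite) (hB : V(B).Finite) :
    (U.compsAvoiding Z).ncard = (A.compsAvoiding Z).ncard + (B.compsAvoiding Z).ncard := by
  have hZ' : V(B) ∩ V(A) ⊆ Z := by rwa [Set.inter_comm]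
  rw [← Set.ncard_union_eq _ (finite_compsAvoiding hA Z) (finite_compsAvoiding hB Z)]
  · congr 1
    refine Set.Subset.antisymm ?_
      (Set.union_subset (h.compsAvoiding_subset hZ) (h.symm.compsAvoiding_subset hZ'))
    rintro C ⟨⟨x, hx, rfl⟩, hC⟩
    rw [h.vertexSet] at hx
    rcases hx with hx | hx
    · left
      have hC' : Disjoint {y | A.Reach x y} Z := hC.mono_left fun y => h.reach_left
      refine ⟨⟨x, hx, ?_⟩, hC⟩
      ext y
      exact h.reach_iff_of_disjoint hZ hC' hx y
    · right
      have hC' : Disjoint {y | B.Reach x y} Z := hC.mono_left fun y => h.reach_right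
      refine ⟨⟨x, hx, ?_⟩, hC⟩
      ext y
      exact h.symm.reach_iff_of_disjoint hZ' hC' hx y
  · rw [Set.disjoint_left]
    rintro C ⟨⟨x, hx, rfl⟩, hC⟩ ⟨⟨y, hy, hxy⟩, -⟩
    have h1 : x ∈ {z | B.Reach y z} := hxy ▸ Reach.refl hx
    exact Set.disjoint_left.1 hC (Reach.refl hx) (hZ ⟨hx, h1.right_mem⟩)

/-- Reachability in a union whose parts share at most the vertex `m`. -/
lemma reach_of_inter_subset_singleton (h : IsAdjUnion A B U) {m : α} (hm : V(A) ∩ V(B) ⊆ {m})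
    {x y : α} (hx : x ∈ V(A)) (hxy : U.Reach x y) :
    A.Reach x y ∨ A.Reach x m ∧ B.Reach m y := by
  obtain ⟨-, hxy⟩ := hxy
  induction hxy with
  | refl => exact .inl (.refl hx)
  | @tail y z _ hyz ih =>
    rcases ih with ih | ⟨ih, ih'⟩ <;> rcases (h.adj y z).1 hyz with hA | hB
    · exact .inl (ih.tail hA)
    · obtain rfl : y = m := hm ⟨ih.right_mem, hB.left_mem⟩
      exact .inr ⟨ih, .tail (.refl hB.left_mem) hB⟩
    · obtain rfl : y = m := hm ⟨hA.left_mem, ih'.right_mem⟩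
      exact .inl (ih.tail hA)
    · exact .inr ⟨ih, ih'.tail hB⟩

lemma reach_left_iff (h : IsAdjUnion A B U) {m : α} (hm : V(A) ∩ V(B) ⊆ {m})
    {x y : α} (hx : x ∈ V(A)) (hy : y ∈ V(A)) : U.Reach x y ↔ A.Reach x y := by
  refine ⟨fun hxy => ?_, h.reach_left⟩
  rcases h.reach_of_inter_subset_singleton hm hx hxy with h' | ⟨h1, h2⟩
  · exact h'
  · obtain rfl : y = m := hm ⟨hy, h2.right_mem⟩
    exact h1

lemma reach_across_iff (h : IsAdjUnion A B U) {m : α} (hm : V(A) ∩ V(B) ⊆ {m})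
    {x y : α} (hx : x ∈ V(A)) (hy : y ∈ V(B)) :
    U.Reach x y ↔ A.Reach x m ∧ B.Reach m y := by
  refine ⟨fun hxy => ?_, fun h' => (h.reach_left h'.1).trans (h.reach_right h'.2)⟩
  rcases h.reach_of_inter_subset_singleton hm hx hxy with h' | h'
  · obtain rfl : y = m := hm ⟨h'.right_mem, hy⟩
    exact ⟨h', .refl hy⟩
  · exact h'

/-- Reachability of `t` from `s` in a union whose parts share at most `s` and `t`. -/
lemma reach_iff_of_inter_subset_pair (h : IsAdjUnion A B U) {s t : α}
    (hst : V(A) ∩ V(B) ⊆ {s, t}) (hsA : s ∈ V(U) → s ∈ V(A)) (hsB : s ∈ V(U) → s ∈ V(B)) :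
    U.Reach s t ↔ A.Reach s t ∨ B.Reach s t := by
  refine ⟨fun ⟨hs, hxy⟩ => ?_, fun h' => h'.elim h.reach_left h.reach_right⟩
  have key : ∀ y, Relation.ReflTransGen U.Adj s y →
      A.Reach s y ∨ B.Reach s y ∨ (A.Reach s t ∨ B.Reach s t) := by
    intro y hy
    induction hy with
    | refl => exact .inl (.refl (hsA hs))
    | @tail y z _ hyz ih =>
      rcases ih with ih | ih | ih
      · rcases (h.adj y z).1 hyz with hA | hB
        · exact .inl (ih.tail hA)
        · rcases hst ⟨ih.right_mem, hB.left_mem⟩ with rfl | rfl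
          · exact .inr (.inl (.tail (.refl hB.left_mem) hB))
          · exact .inr (.inr (.inl ih))
      · rcases (h.adj y z).1 hyz with hA | hB
        · rcases hst ⟨hA.left_mem, ih.right_mem⟩ with rfl | rfl
          · exact .inl (.tail (.refl hA.left_mem) hA)
          · exact .inr (.inr (.inr ih))
        · exact .inr (.inl (ih.tail hB))
      · exact .inr (.inr ih)
  have := key t hxy
  tauto

end IsAdjUnion

lemma compsAvoiding_congr {H : Graph α β} {Z Z' : Set α} (h : ∀ x ∈ V(H), x ∈ Z ↔ x ∈ Z') :
    H.compsAvoiding Z = H.compsAvoiding Z' := by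
  ext C
  refine and_congr_right ?_
  rintro ⟨x, hx, rfl⟩
  simp only [Set.disjoint_left]
  exact forall₂_congr fun y (hy : H.Reach x y) => not_congr (h y hy.right_mem)

lemma deleteVerts_congr {H : Graph α β} {S T : Set α} (h : ∀ x ∈ V(H), x ∈ S ↔ x ∈ T) :
    H.deleteVerts S = H.deleteVerts T := by
  refine Graph.ext ?_ fun e x y => ?_
  · ext x
    simp only [vertexSet_deleteVerts, Set.mem_sdiff]
    exact and_congr_right fun hx => not_congr (h x hx)
  · simp only [deleteVerts_isLink]
    refine and_congr_right fun hl => ?_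
    rw [h x hl.left_mem, h y hl.right_mem]

end Graph

/-! ### Surplus of two-terminal graphs -/

/-- The number of components of `Γ - S`, minus twice the number of vertices of `Γ` in `S`. The set
`S` need not consist of vertices of `Γ`. So `Γ` is `1/2`-tough when this is at most `0` for all `S`
such that `Γ - S` has more than one component. -/
noncomputable def Graph.excess {α β : Type*} (Γ : Graph α β) (S : Set α) : ℤ :=
  ((Γ.deleteVerts S).numComponents : ℤ) - 2 * ((S ∩ V(Γ)).ncard : ℤ)

namespace TwoTerminalGraph

variable {α β : Type*} {G H A B X K J M : TwoTerminalGraph α β} {S T : Set α} {e : β}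

/-- The two terminals are distinct vertices, and there are finitely many vertices. -/
structure IsProper (G : TwoTerminalGraph α β) : Prop where
  source_mem : G.source ∈ V(G.graph)
  target_mem : G.target ∈ V(G.graph)
  ne : G.source ≠ G.target
  finite : V(G.graph).Finite

/-- The two terminals are joined by a path in `G - S`. -/
def Linked (G : TwoTerminalGraph α β) (S : Set α) : Prop :=
  (G.graph.deleteVerts S).Reach G.source G.target

/-- The number of components of `G - S` that contain no terminal, minus twice the number of
inner vertices in `S`. -/
noncomputable def surplus (G : TwoTerminalGraph α β) (S : Set α) : ℤ :=
  (((G.graph.deleteVerts S).compsAvoiding {G.source, G.target}).ncard : ℤ) -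
    2 * (((S ∩ V(G.graph)) \ {G.source, G.target}).ncard : ℤ)

/-- `G` with its terminals exchanged. -/
def rev (G : TwoTerminalGraph α β) : TwoTerminalGraph α β := ⟨G.graph, G.target, G.source⟩

@[simp] lemma rev_graph : G.rev.graph = G.graph := rfl
@[simp] lemma rev_source : G.rev.source = G.target := rfl
@[simp] lemma rev_target : G.rev.target = G.source := rfl
@[simp] lemma rev_rev : G.rev.rev = G := rfl

lemma IsProper.rev (h : G.IsProper) : G.rev.IsProper :=
  ⟨h.target_mem, h.source_mem, h.ne.symm, h.finite⟩

@[simp] lemma surplus_rev : G.rev.surplus S = G.surplus S := by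
  simp only [surplus, rev_graph, rev_source, rev_target, Set.pair_comm]

@[simp] lemma linked_rev : G.rev.Linked S ↔ G.Linked S := Graph.reach_comm

lemma Linked.source_notMem (h : G.Linked S) : G.source ∉ S := by
  have := Graph.Reach.left_mem h
  simp only [Graph.vertexSet_deleteVerts] at this
  exact this.2

lemma Linked.target_notMem (h : G.Linked S) : G.target ∉ S := by
  have := Graph.Reach.right_mem h
  simp only [Graph.vertexSet_deleteVerts] at this
  exact this.2

lemma surplus_congr (h : ∀ x ∈ V(G.graph), x ∈ S ↔ x ∈ T) : G.surplus S = G.surplus T := by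
  have h' : S ∩ V(G.graph) = T ∩ V(G.graph) := by
    ext x
    simp only [Set.mem_inter_iff]
    exact and_congr_left fun hx => h x hx
  simp only [surplus, Graph.deleteVerts_congr h, h']

lemma linked_congr (h : ∀ x ∈ V(G.graph), x ∈ S ↔ x ∈ T) : G.Linked S ↔ G.Linked T := by
  simp only [Linked, Graph.deleteVerts_congr h]

lemma surplus_eq_of_avoids (h : ∀ x ∈ V(G.graph), x ∉ S) : G.surplus S = G.surplus ∅ :=
  surplus_congr fun x hx => by simp [h x hx]

lemma linked_iff_of_avoids (h : ∀ x ∈ V(G.graph), x ∉ S) : G.Linked S ↔ G.Linked ∅ :=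
  linked_congr fun x hx => by simp [h x hx]

lemma surplus_eq_zero_of_vertexSet_subset (h : V(G.graph) ⊆ {G.source, G.target}) :
    G.surplus S = 0 := by
  have h1 : (G.graph.deleteVerts S).compsAvoiding {G.source, G.target} = ∅ := by
    ext C
    simp only [Set.mem_empty_iff_false, iff_false]
    rintro ⟨⟨x, hx, rfl⟩, hC⟩
    refine Set.disjoint_left.1 hC (Graph.Reach.refl hx) (h ?_)
    simp only [Graph.vertexSet_deleteVerts] at hx
    exact hx.1
  have h2 : (S ∩ V(G.graph)) \ {G.source, G.target} = ∅ :=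
    Set.sdiff_eq_empty.2 (Set.inter_subset_right.trans h)
  simp [surplus, h1, h2]

lemma surplus_nonneg_of_subset (h : S ⊆ {G.source, G.target}) : 0 ≤ G.surplus S := by
  have h2 : (S ∩ V(G.graph)) \ {G.source, G.target} = ∅ :=
    Set.sdiff_eq_empty.2 (Set.inter_subset_left.trans h)
  simp [surplus, h2]

open Classical in
/-- The number of components in terms of the components without terminals. -/
lemma numComponents_eq (hG : G.IsProper) (S : Set α) :
    (G.graph.deleteVerts S).numComponents =
      ((G.graph.deleteVerts S).compsAvoiding {G.source, G.target}).ncard +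
      (if G.source ∉ S ∧ ¬ G.Linked S then 1 else 0) + (if G.target ∉ S then 1 else 0) := by
  have hfin : V(G.graph.deleteVerts S).Finite := by
    simp only [Graph.vertexSet_deleteVerts]
    exact hG.finite.sdiff
  rw [Graph.numComponents_eq_ncard, Graph.ncard_compsAvoiding_insert hfin ∅ G.target,
    Graph.ncard_compsAvoiding_insert hfin (insert G.target ∅) G.source]
  simp only [insert_empty_eq, Linked, Graph.vertexSet_deleteVerts, Set.mem_sdiff,
    hG.source_mem, hG.target_mem, true_and, Set.mem_singleton_iff, forall_eq,
    Set.mem_empty_iff_false, false_imp_iff, implies_true, and_true]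
  congr

lemma excess_of_mem_of_mem (hG : G.IsProper) (hs : G.source ∈ S) (ht : G.target ∈ S) :
    G.graph.excess S = G.surplus S - 4 := by
  have h : S ∩ V(G.graph) =
      insert G.source (insert G.target ((S ∩ V(G.graph)) \ {G.source, G.target})) := by
    ext x
    have h1 := hG.source_mem
    have h2 := hG.target_mem
    simp only [Set.mem_inter_iff, Set.mem_insert_iff, Set.mem_sdiff, Set.mem_singleton_iff]
    by_cases h3 : x = G.source <;> by_cases h4 : x = G.target <;> simp_all
  have hfin : (S ∩ V(G.graph)).Finite := hG.finite.inter_of_right _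
  rw [Graph.excess, numComponents_eq hG, surplus, h, Set.ncard_insert_of_notMem _
    ((hfin.sdiff).insert _), Set.ncard_insert_of_notMem _ hfin.sdiff, ← h]
  · simp only [hs, ht, not_true, false_and, if_false]
    push_cast
    ring
  · simp
  · simp [hG.ne]

lemma excess_of_notMem_of_mem (hG : G.IsProper) (hs : G.source ∉ S) (ht : G.target ∈ S) :
    G.graph.excess S = G.surplus S - 1 := by
  have h : S ∩ V(G.graph) = insert G.target ((S ∩ V(G.graph)) \ {G.source, G.target}) := by
    ext x
    have h2 := hG.target_mem
    simp only [Set.mem_inter_iff, Set.mem_insert_iff, Set.mem_sdiff, Set.mem_singleton_iff]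
    by_cases h3 : x = G.source <;> by_cases h4 : x = G.target <;> simp_all
  have hfin : (S ∩ V(G.graph)).Finite := hG.finite.inter_of_right _
  have hl : ¬ G.Linked S := fun hl => hl.target_notMem ht
  rw [Graph.excess, numComponents_eq hG, surplus, h, Set.ncard_insert_of_notMem _ hfin.sdiff, ← h]
  · simp only [hs, ht, hl, not_true, not_false_eq_true, true_and, if_false, if_true]
    push_cast
    ring
  · simp

lemma excess_of_mem_of_notMem (hG : G.IsProper) (hs : G.source ∈ S) (ht : G.target ∉ S) :
    G.graph.excess S = G.surplus S - 1 := by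
  simpa using excess_of_notMem_of_mem hG.rev ht hs

open Classical in
lemma excess_of_notMem_of_notMem (hG : G.IsProper) (hs : G.source ∉ S) (ht : G.target ∉ S) :
    G.graph.excess S = G.surplus S + if G.Linked S then 1 else 2 := by
  have h : S ∩ V(G.graph) = (S ∩ V(G.graph)) \ {G.source, G.target} := by
    ext x
    simp only [Set.mem_inter_iff, Set.mem_insert_iff, Set.mem_sdiff, Set.mem_singleton_iff]
    by_cases h3 : x = G.source <;> by_cases h4 : x = G.target <;> simp_all
  rw [Graph.excess, numComponents_eq hG, surplus, ← h]
  by_cases hl : G.Linked S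
  · simp [hs, ht, hl]
    ring
  · simp [hs, ht, hl]
    ring

/-! ### Joins -/

lemma IsEdgeDisjointUnion.isAdjUnion {A B G : Graph α β} (h : IsEdgeDisjointUnion A B G) :
    Graph.IsAdjUnion A B G where
  vertexSet := h.2.1
  adj x y := by
    simp only [Graph.Adj, h.2.2, exists_or]

lemma IsEdgeDisjointUnion.symm {A B G : Graph α β} (h : IsEdgeDisjointUnion A B G) :
    IsEdgeDisjointUnion B A G :=
  ⟨h.1.symm, by rw [h.2.1, Set.union_comm], fun e x y => by rw [h.2.2, or_comm]⟩

lemma IsParallelJoin₂.symm (h : IsParallelJoin₂ A B G) : IsParallelJoin₂ B A G :=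
  ⟨h.2.1, h.1, h.2.2.2.1, h.2.2.1, by rw [Set.inter_comm]; exact h.2.2.2.2.1, h.2.2.2.2.2.symm⟩

lemma IsParallelJoin₂.rev (h : IsParallelJoin₂ A B G) : IsParallelJoin₂ A.rev B.rev G.rev :=
  ⟨h.2.2.1, h.2.2.2.1, h.1, h.2.1, h.2.2.2.2.1.trans (Set.pair_comm _ _), h.2.2.2.2.2⟩

lemma IsSeriesJoin₂.rev (h : IsSeriesJoin₂ A B G) : IsSeriesJoin₂ B.rev A.rev G.rev :=
  ⟨h.2.2.1, h.2.1.symm, h.1, by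
    rw [Set.inter_comm]
    exact h.2.2.2.1.trans (congrArg _ h.2.1), h.2.2.2.2.symm⟩

lemma IsParallelJoin₂.isProper (h : IsParallelJoin₂ A B G) (hA : A.IsProper) (hB : B.IsProper) :
    G.IsProper := by
  obtain ⟨h1, h2, h3, h4, h5, h6⟩ := h
  refine ⟨?_, ?_, ?_, ?_⟩
  · rw [h6.2.1, ← h1]; exact .inl hA.source_mem
  · rw [h6.2.1, ← h3]; exact .inl hA.target_mem
  · rw [← h1, ← h3]; exact hA.ne
  · rw [h6.2.1]; exact hA.finite.union hB.finite

lemma IsSeriesJoin₂.source_notMem (h : IsSeriesJoin₂ A B G) (hA : A.IsProper) :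
    A.source ∉ V(B.graph) := fun h' => hA.ne (by
  have : A.source ∈ V(A.graph) ∩ V(B.graph) := ⟨hA.source_mem, h'⟩
  rw [h.2.2.2.1] at this
  exact this)

lemma IsSeriesJoin₂.target_notMem (h : IsSeriesJoin₂ A B G) (hB : B.IsProper) :
    B.target ∉ V(A.graph) := h.rev.source_notMem hB.rev

lemma IsSeriesJoin₂.isProper (h : IsSeriesJoin₂ A B G) (hA : A.IsProper) (hB : B.IsProper) :
    G.IsProper := by
  have hs := h.source_notMem hA
  obtain ⟨h1, h2, h3, h4, h5⟩ := h
  refine ⟨?_, ?_, ?_, ?_⟩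
  · rw [h5.2.1, h1]; exact .inl hA.source_mem
  · rw [h5.2.1, h3]; exact .inr hB.target_mem
  · rw [h1, h3]; rintro h; exact hs (h ▸ hB.target_mem)
  · rw [h5.2.1]; exact hA.finite.union hB.finite

lemma finite_vertexSet_deleteVerts (hG : G.IsProper) (S : Set α) :
    V(G.graph.deleteVerts S).Finite := by
  simp only [Graph.vertexSet_deleteVerts]
  exact hG.finite.sdiff

lemma IsParallelJoin₂.surplus (h : IsParallelJoin₂ A B G) (hA : A.IsProper) (hB : B.IsProper)
    (S : Set α) : G.surplus S = A.surplus S + B.surplus S := by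
  obtain ⟨h1, h2, h3, h4, h5, h6⟩ := h
  have hc := (h6.isAdjUnion.deleteVerts S).ncard_compsAvoiding (Z := {G.source, G.target}) (by
      rw [← h5]
      simp only [Graph.vertexSet_deleteVerts]
      exact Set.inter_subset_inter Set.sdiff_subset Set.sdiff_subset)
    (finite_vertexSet_deleteVerts hA S) (finite_vertexSet_deleteVerts hB S)
  have hi : ((S ∩ V(G.graph)) \ {G.source, G.target}).ncard =
      ((S ∩ V(A.graph)) \ {G.source, G.target}).ncard +
      ((S ∩ V(B.graph)) \ {G.source, G.target}).ncard := by
    rw [← Set.ncard_union_eq _ (hA.finite.inter_of_right _).sdiff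
      (hB.finite.inter_of_right _).sdiff, h6.2.1, Set.inter_union_distrib_left,
      Set.union_sdiff_distrib]
    rw [Set.disjoint_left]
    rintro x ⟨hx, hx'⟩ ⟨hy, -⟩
    exact hx' (h5 ▸ ⟨hx.2, hy.2⟩)
  simp only [TwoTerminalGraph.surplus, h1, h2, h3, h4, hc, hi]
  push_cast
  ring

lemma IsParallelJoin₂.linked (h : IsParallelJoin₂ A B G) (hA : A.IsProper) (hB : B.IsProper)
    (S : Set α) : G.Linked S ↔ A.Linked S ∨ B.Linked S := by
  obtain ⟨h1, h2, h3, h4, h5, h6⟩ := h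
  have := (h6.isAdjUnion.deleteVerts S).reach_iff_of_inter_subset_pair (s := G.source)
    (t := G.target) (by
      rw [← h5]
      simp only [Graph.vertexSet_deleteVerts]
      exact Set.inter_subset_inter Set.sdiff_subset Set.sdiff_subset)
    (by simp only [Graph.vertexSet_deleteVerts]; exact fun h => ⟨h1 ▸ hA.source_mem, h.2⟩)
    (by simp only [Graph.vertexSet_deleteVerts]; exact fun h => ⟨h2 ▸ hB.source_mem, h.2⟩)
  simp only [Linked, h1, h2, h3, h4, this]

lemma IsSeriesJoin₂.linked (h : IsSeriesJoin₂ A B G) (hA : A.IsProper) (hB : B.IsProper)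
    (S : Set α) : G.Linked S ↔ A.Linked S ∧ B.Linked S := by
  have hp := h.isProper hA hB
  obtain ⟨h1, h2, h3, h4, h5⟩ := h
  have hi : V(A.graph.deleteVerts S) ∩ V(B.graph.deleteVerts S) ⊆ {A.target} := by
    rw [← h4]
    simp only [Graph.vertexSet_deleteVerts]
    exact Set.inter_subset_inter Set.sdiff_subset Set.sdiff_subset
  by_cases hs : G.source ∈ S
  · refine iff_of_false (fun h => h.source_notMem hs) fun h => h.1.source_notMem (h1 ▸ hs)
  by_cases ht : G.target ∈ S
  · refine iff_of_false (fun h => h.target_notMem ht) fun h => h.2.target_notMem (h3 ▸ ht)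
  have := (h5.isAdjUnion.deleteVerts S).reach_across_iff hi (x := G.source) (y := G.target)
    (by simp only [Graph.vertexSet_deleteVerts]; exact ⟨h1 ▸ hA.source_mem, hs⟩)
    (by simp only [Graph.vertexSet_deleteVerts]; exact ⟨h3 ▸ hB.target_mem, ht⟩)
  simp only [h1, h3, h2] at this
  simp only [Linked, h1, h3, h2, this]

lemma IsSeriesJoin₂.ncard_inner (h : IsSeriesJoin₂ A B G) (hA : A.IsProper) (hB : B.IsProper)
    (S : Set α) [Decidable (A.target ∈ S)] :
    ((S ∩ V(G.graph)) \ {G.source, G.target}).ncard =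
      ((S ∩ V(A.graph)) \ {A.source, A.target}).ncard +
      ((S ∩ V(B.graph)) \ {B.source, B.target}).ncard + if A.target ∈ S then 1 else 0 := by
  have hs := h.source_notMem hA
  have ht := h.target_notMem hB
  have hmA := hA.target_mem
  have hmB := hB.source_mem
  have hne := hA.ne
  have hne' := hB.ne
  obtain ⟨h1, h2, h3, h4, h5⟩ := h
  have h4' : ∀ x, x ∈ V(A.graph) → x ∈ V(B.graph) → x = A.target := fun x hx hx' => by
    have : x ∈ V(A.graph) ∩ V(B.graph) := ⟨hx, hx'⟩
    rwa [h4] at this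
  have hd : Disjoint ((S ∩ V(A.graph)) \ {A.source, A.target})
      ((S ∩ V(B.graph)) \ {B.source, B.target}) := by
    rw [Set.disjoint_left]
    rintro x ⟨hx, hx'⟩ ⟨hy, -⟩
    exact hx' (.inr (h4' x hx.2 hy.2))
  have hfA : ((S ∩ V(A.graph)) \ {A.source, A.target}).Finite :=
    (hA.finite.inter_of_right _).sdiff
  have hfB : ((S ∩ V(B.graph)) \ {B.source, B.target}).Finite :=
    (hB.finite.inter_of_right _).sdiff
  rw [← Set.ncard_union_eq hd hfA hfB]
  rw [h1, h3, h5.2.1]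
  rw [← h2] at hmB hne' ⊢
  split_ifs with hm
  · rw [← Set.ncard_insert_of_notMem (a := A.target) _ (hfA.union (h2 ▸ hfB))]
    · congr 1
      ext x
      simp only [Set.mem_sdiff, Set.mem_inter_iff, Set.mem_union, Set.mem_insert_iff,
        Set.mem_singleton_iff]
      by_cases hx1 : x = A.source
      · subst hx1; simp [hs, hne]
      by_cases hx2 : x = B.target
      · subst hx2; simp [ht, hne'.symm]
      by_cases hx3 : x = A.target
      · subst hx3; simp [hm, hmA, hne.symm, hne']
      simp [hx1, hx2, hx3]
      tauto
    · simp
  · rw [add_zero]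
    congr 1
    ext x
    simp only [Set.mem_sdiff, Set.mem_inter_iff, Set.mem_union, Set.mem_insert_iff,
      Set.mem_singleton_iff]
    by_cases hx1 : x = A.source
    · subst hx1; simp [hs]
    by_cases hx2 : x = B.target
    · subst hx2; simp [ht]
    by_cases hx3 : x = A.target
    · subst hx3; simp [hm]
    simp [hx1, hx2, hx3]
    tauto

open Classical in
/-- In a series join, the middle vertex is paid for if it lies in `S`, and otherwise it lies in a
new component without terminals if it is cut off from both terminals. -/
lemma IsSeriesJoin₂.surplus (h : IsSeriesJoin₂ A B G) (hA : A.IsProper) (hB : B.IsProper)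
    (S : Set α) : G.surplus S = A.surplus S + B.surplus S +
      if A.target ∈ S then -2 else if A.Linked S ∨ B.Linked S then 0 else 1 := by
  have hp := h.isProper hA hB
  have hs := h.source_notMem hA
  have ht := h.target_notMem hB
  have hn := h.ncard_inner hA hB S
  obtain ⟨h1, h2, h3, h4, h5⟩ := h
  have hi : V(A.graph.deleteVerts S) ∩ V(B.graph.deleteVerts S) ⊆ {A.target} := by
    rw [← h4]
    simp only [Graph.vertexSet_deleteVerts]
    exact Set.inter_subset_inter Set.sdiff_subset Set.sdiff_subset
  have hi' := hi
  rw [Set.inter_comm] at hi'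
  have hU := h5.isAdjUnion.deleteVerts S
  have hmV : A.target ∈ V(G.graph) := by rw [h5.2.1]; exact .inl hA.target_mem
  have hmB : A.target ∈ V(B.graph) := h2 ▸ hB.source_mem
  have hc : ((G.graph.deleteVerts S).compsAvoiding {G.source, G.target}).ncard =
      ((A.graph.deleteVerts S).compsAvoiding {A.source, A.target}).ncard +
      ((B.graph.deleteVerts S).compsAvoiding {B.source, B.target}).ncard +
      if A.target ∉ S ∧ ¬ A.Linked S ∧ ¬ B.Linked S then 1 else 0 := by
    rw [Graph.ncard_compsAvoiding_insert (finite_vertexSet_deleteVerts hp S) _ A.target,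
      hU.ncard_compsAvoiding (hi.trans (by simp)) (finite_vertexSet_deleteVerts hA S)
      (finite_vertexSet_deleteVerts hB S)]
    congr 1
    · congr 2
      · refine Graph.compsAvoiding_congr fun x hx => ?_
        simp only [Graph.vertexSet_deleteVerts] at hx
        simp only [Set.mem_insert_iff, Set.mem_singleton_iff, h1, h3]
        have : x ≠ B.target := fun h => ht (h ▸ hx.1)
        tauto
      · refine Graph.compsAvoiding_congr fun x hx => ?_
        simp only [Graph.vertexSet_deleteVerts] at hx
        simp only [Set.mem_insert_iff, Set.mem_singleton_iff, h1, h3, h2]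
        have : x ≠ A.source := fun h => hs (h ▸ hx.1)
        tauto
    · refine if_congr ?_ rfl rfl
      simp only [Graph.vertexSet_deleteVerts, Set.mem_sdiff, hmV, true_and]
      refine and_congr_right fun hm => ?_
      have hmA' : A.target ∈ V(A.graph.deleteVerts S) := by
        simp only [Graph.vertexSet_deleteVerts]; exact ⟨hA.target_mem, hm⟩
      have hmB' : A.target ∈ V(B.graph.deleteVerts S) := by
        simp only [Graph.vertexSet_deleteVerts]; exact ⟨hmB, hm⟩
      have e1 : (G.graph.deleteVerts S).Reach A.target G.source ↔ A.Linked S := by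
        by_cases hsS : G.source ∈ S
        · refine iff_of_false (fun h => ?_) fun h => h.source_notMem (h1 ▸ hsS)
          have := h.right_mem
          simp only [Graph.vertexSet_deleteVerts] at this
          exact this.2 hsS
        · rw [hU.reach_left_iff hi hmA', Linked, Graph.reach_comm, h1]
          simp only [Graph.vertexSet_deleteVerts]; exact ⟨h1 ▸ hA.source_mem, hsS⟩
      have e2 : (G.graph.deleteVerts S).Reach A.target G.target ↔ B.Linked S := by
        by_cases hsS : G.target ∈ S
        · refine iff_of_false (fun h => ?_) fun h => h.target_notMem (h3 ▸ hsS)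
          have := h.right_mem
          simp only [Graph.vertexSet_deleteVerts] at this
          exact this.2 hsS
        · rw [hU.symm.reach_left_iff hi' hmB', Linked, h3, h2]
          simp only [Graph.vertexSet_deleteVerts]; exact ⟨h3 ▸ hB.target_mem, hsS⟩
      simp [e1, e2]
  simp only [TwoTerminalGraph.surplus, hc, hn]
  by_cases hm : A.target ∈ S
  · simp [hm]
    ring
  · by_cases hl : A.Linked S ∨ B.Linked S
    · have : ¬ (¬ A.Linked S ∧ ¬ B.Linked S) := by tauto
      simp [hm, hl, this]
      ring
    · have hl' := not_or.1 hl
      simp [hm, hl'.1, hl'.2]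
      ring

/-! ### Gluing vertex sets -/

lemma exists_glue {V W T₁ T₂ : Set α} (h : ∀ x ∈ V ∩ W, x ∈ T₁ ↔ x ∈ T₂) :
    ∃ T : Set α, (∀ x ∈ V, x ∈ T ↔ x ∈ T₁) ∧ ∀ x ∈ W, x ∈ T ↔ x ∈ T₂ := by
  refine ⟨T₁ ∩ V ∪ T₂ ∩ W, fun x hx => ?_, fun x hx => ?_⟩
  · have := h x
    simp only [Set.mem_inter_iff, Set.mem_union] at *
    tauto
  · have := h x
    simp only [Set.mem_inter_iff, Set.mem_union] at *
    tauto

lemma IsParallelJoin₂.exists_glue (h : IsParallelJoin₂ A B G) (hA : A.IsProper)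
    (hB : B.IsProper) {T₁ T₂ : Set α} (hs : G.source ∈ T₁ ↔ G.source ∈ T₂)
    (ht : G.target ∈ T₁ ↔ G.target ∈ T₂) :
    ∃ T : Set α, (G.source ∈ T ↔ G.source ∈ T₁) ∧ (G.target ∈ T ↔ G.target ∈ T₁) ∧
      (∀ x ∈ V(A.graph), x ∈ T ↔ x ∈ T₁) ∧ (∀ x ∈ V(B.graph), x ∈ T ↔ x ∈ T₂) ∧
      G.surplus T = A.surplus T₁ + B.surplus T₂ := by
  obtain ⟨T, hT₁, hT₂⟩ := TwoTerminalGraph.exists_glue (V := V(A.graph)) (W := V(B.graph))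
    (T₁ := T₁) (T₂ := T₂) (by rw [h.2.2.2.2.1]; rintro x (rfl | rfl) <;> assumption)
  refine ⟨T, hT₁ _ (h.1 ▸ hA.source_mem), hT₁ _ (h.2.2.1 ▸ hA.target_mem), hT₁, hT₂, ?_⟩
  rw [h.surplus hA hB, surplus_congr hT₁, surplus_congr hT₂]

open Classical in
lemma IsSeriesJoin₂.exists_glue (h : IsSeriesJoin₂ A B G) (hA : A.IsProper)
    (hB : B.IsProper) {T₁ T₂ : Set α} (hm : A.target ∈ T₁ ↔ A.target ∈ T₂) :
    ∃ T : Set α, (A.source ∈ T ↔ A.source ∈ T₁) ∧ (B.target ∈ T ↔ B.target ∈ T₂) ∧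
      (∀ x ∈ V(A.graph), x ∈ T ↔ x ∈ T₁) ∧ (∀ x ∈ V(B.graph), x ∈ T ↔ x ∈ T₂) ∧
      G.surplus T = A.surplus T₁ + B.surplus T₂ +
      if A.target ∈ T₁ then -2 else if A.Linked T₁ ∨ B.Linked T₂ then 0 else 1 := by
  obtain ⟨T, hT₁, hT₂⟩ := TwoTerminalGraph.exists_glue (V := V(A.graph)) (W := V(B.graph))
    (T₁ := T₁) (T₂ := T₂) (by rw [h.2.2.2.1]; rintro x rfl; assumption)
  refine ⟨T, hT₁ _ hA.source_mem, hT₂ _ hB.target_mem, hT₁, hT₂, ?_⟩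
  rw [h.surplus hA hB, surplus_congr hT₁, surplus_congr hT₂, linked_congr hT₁, linked_congr hT₂,
    hT₁ _ hA.target_mem]

/-! ### Connected two-terminal graphs -/

/-- The terminals are linked, and every component contains a terminal; so the graph is
connected. -/
structure IsTidy (G : TwoTerminalGraph α β) : Prop extends G.IsProper where
  linked : G.Linked ∅
  surplus_empty : G.surplus ∅ = 0

lemma IsTidy.rev (h : G.IsTidy) : G.rev.IsTidy :=
  ⟨h.toIsProper.rev, linked_rev.2 h.linked, by rw [surplus_rev, h.surplus_empty]⟩

lemma IsSingleEdge.vertexSet (h : G.IsSingleEdge) : V(G.graph) = {G.source, G.target} := by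
  obtain ⟨-, e, he⟩ := h
  rw [he]
  rfl

lemma IsSingleEdge.isProper (h : G.IsSingleEdge) : G.IsProper where
  source_mem := by simp [h.vertexSet]
  target_mem := by simp [h.vertexSet]
  ne := h.1
  finite := by simp [h.vertexSet]

lemma IsSingleEdge.surplus (h : G.IsSingleEdge) (S : Set α) : G.surplus S = 0 :=
  surplus_eq_zero_of_vertexSet_subset h.vertexSet.subset

lemma IsSingleEdge.isTidy (h : G.IsSingleEdge) : G.IsTidy := by
  refine ⟨h.isProper, ?_, h.surplus _⟩
  obtain ⟨-, e, he⟩ := id h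
  refine ⟨by simpa using h.isProper.source_mem, Relation.ReflTransGen.single ⟨e, ?_⟩⟩
  rw [Graph.deleteVerts_empty, he]
  simp

lemma IsSingleEdge.rev (h : G.IsSingleEdge) : G.rev.IsSingleEdge := by
  obtain ⟨h, e, he⟩ := h
  exact ⟨h.symm, e, he.trans (Graph.banana_comm _ _ _)⟩

lemma IsParallelJoin₂.isTidy (h : IsParallelJoin₂ A B G) (hA : A.IsTidy) (hB : B.IsTidy) :
    G.IsTidy where
  toIsProper := h.isProper hA.toIsProper hB.toIsProper
  linked := (h.linked hA.toIsProper hB.toIsProper ∅).2 (.inl hA.linked)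
  surplus_empty := by
    rw [h.surplus hA.toIsProper hB.toIsProper, hA.surplus_empty, hB.surplus_empty, add_zero]

lemma IsSeriesJoin₂.isTidy (h : IsSeriesJoin₂ A B G) (hA : A.IsTidy) (hB : B.IsTidy) :
    G.IsTidy where
  toIsProper := h.isProper hA.toIsProper hB.toIsProper
  linked := (h.linked hA.toIsProper hB.toIsProper ∅).2 ⟨hA.linked, hB.linked⟩
  surplus_empty := by
    classical
    rw [h.surplus hA.toIsProper hB.toIsProper, hA.surplus_empty, hB.surplus_empty]
    simp [hA.linked]

lemma IsSeriesParallel.isTidy (h : G.IsSeriesParallel) : G.IsTidy := by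
  induction h with
  | edge h => exact h.isTidy
  | series _ _ h hA hB => exact h.isTidy hA hB
  | parallel _ _ h hA hB => exact h.isTidy hA hB

lemma IsSeriesParallel.isProper (h : G.IsSeriesParallel) : G.IsProper := h.isTidy.toIsProper

/-! ### Deleting an edge -/

/-- `G - e`, with the same terminals. -/
def deleteEdge (G : TwoTerminalGraph α β) (e : β) : TwoTerminalGraph α β :=
  ⟨G.graph.deleteEdges {e}, G.source, G.target⟩

@[simp] lemma deleteEdge_graph : (G.deleteEdge e).graph = G.graph.deleteEdges {e} := rfl
@[simp] lemma deleteEdge_source : (G.deleteEdge e).source = G.source := rfl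
@[simp] lemma deleteEdge_target : (G.deleteEdge e).target = G.target := rfl
@[simp] lemma deleteEdge_rev : G.rev.deleteEdge e = (G.deleteEdge e).rev := rfl

lemma deleteEdge_of_notMem (h : e ∉ E(G.graph)) : G.deleteEdge e = G := by
  obtain ⟨Γ, s, t⟩ := G
  simp only [deleteEdge, mk.injEq, and_true]
  refine Graph.ext rfl fun f x y => ?_
  simp only [Graph.deleteEdges_isLink, Set.mem_singleton_iff, and_iff_left_iff_imp]
  rintro hf rfl
  exact h hf.edge_mem

lemma IsProper.deleteEdge (h : G.IsProper) (e : β) : (G.deleteEdge e).IsProper :=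
  ⟨h.source_mem, h.target_mem, h.ne, h.finite⟩

lemma IsEdgeDisjointUnion.deleteEdges {A B G : Graph α β} (h : IsEdgeDisjointUnion A B G)
    (F : Set β) :
    IsEdgeDisjointUnion (A.deleteEdges F) (B.deleteEdges F) (G.deleteEdges F) := by
  refine ⟨?_, h.2.1, fun e x y => ?_⟩
  · exact h.1.mono Set.sdiff_subset Set.sdiff_subset
  · simp only [Graph.deleteEdges_isLink, h.2.2]
    tauto

lemma IsParallelJoin₂.deleteEdge (h : IsParallelJoin₂ A B G) (e : β) :
    IsParallelJoin₂ (A.deleteEdge e) (B.deleteEdge e) (G.deleteEdge e) :=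
  ⟨h.1, h.2.1, h.2.2.1, h.2.2.2.1, h.2.2.2.2.1, h.2.2.2.2.2.deleteEdges _⟩

lemma IsSeriesJoin₂.deleteEdge (h : IsSeriesJoin₂ A B G) (e : β) :
    IsSeriesJoin₂ (A.deleteEdge e) (B.deleteEdge e) (G.deleteEdge e) :=
  ⟨h.1, h.2.1, h.2.2.1, h.2.2.2.1, h.2.2.2.2.deleteEdges _⟩

lemma IsEdgeDisjointUnion.edgeSet {A B G : Graph α β} (h : IsEdgeDisjointUnion A B G) :
    E(G) = E(A) ∪ E(B) := by
  ext e
  simp only [Set.mem_union, Graph.edge_mem_iff_exists_isLink, h.2.2, exists_or]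

lemma IsEdgeDisjointUnion.notMem_or_notMem {A B G : Graph α β} (h : IsEdgeDisjointUnion A B G)
    (e : β) : e ∉ E(A) ∨ e ∉ E(B) := by
  by_contra! he
  exact Set.disjoint_left.1 h.1 he.1 he.2

lemma Linked.of_deleteEdge (h : (G.deleteEdge e).Linked S) : G.Linked S := by
  refine Graph.Reach.mono ?_ ?_ h
  · simp
  · intro x y
    simp only [Graph.Adj, Graph.deleteVerts_isLink, deleteEdge_graph, Graph.deleteEdges_isLink]
    rintro ⟨f, hf⟩
    exact ⟨f, hf.1.1, hf.2⟩

/-- Deleting an edge splits at most one component into two. -/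
lemma IsSeriesParallel.surplus_deleteEdge_le (h : G.IsSeriesParallel) (e : β) (S : Set α) :
    (G.deleteEdge e).surplus S ≤ G.surplus S + 1 ∧
    (G.Linked S → ¬ (G.deleteEdge e).Linked S → (G.deleteEdge e).surplus S ≤ G.surplus S) := by
  classical
  induction h with
  | @edge G h =>
    have h1 : (G.deleteEdge e).surplus S = 0 :=
      surplus_eq_zero_of_vertexSet_subset (by exact h.vertexSet.subset)
    rw [h1, h.surplus]
    simp
  | @series A B G hA hB h ihA ihB =>
    have h1 := h.surplus hA.isProper hB.isProper S
    have h2 := (h.deleteEdge e).surplus (hA.isProper.deleteEdge e) (hB.isProper.deleteEdge e) S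
    have h3 := h.linked hA.isProper hB.isProper S
    have h4 := (h.deleteEdge e).linked (hA.isProper.deleteEdge e) (hB.isProper.deleteEdge e) S
    have mA : (A.deleteEdge e).Linked S → A.Linked S := Linked.of_deleteEdge
    have mB : (B.deleteEdge e).Linked S → B.Linked S := Linked.of_deleteEdge
    rw [h1, h2, h3, h4]
    clear h1 h2 h3 h4
    rcases h.2.2.2.2.notMem_or_notMem e with he | he <;>
    · simp only [deleteEdge_of_notMem he, deleteEdge_target] at *
      grind
  | @parallel A B G hA hB h ihA ihB =>
    have h1 := h.surplus hA.isProper hB.isProper S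
    have h2 := (h.deleteEdge e).surplus (hA.isProper.deleteEdge e) (hB.isProper.deleteEdge e) S
    have h3 := h.linked hA.isProper hB.isProper S
    have h4 := (h.deleteEdge e).linked (hA.isProper.deleteEdge e) (hB.isProper.deleteEdge e) S
    rw [h1, h2, h3, h4]
    clear h1 h2 h3 h4
    rcases h.2.2.2.2.2.notMem_or_notMem e with he | he <;>
    · simp only [deleteEdge_of_notMem he] at *
      constructor
      · omega
      · rintro l1 l2
        rcases l1 with l1 | l1 <;> simp_all

/-- After deleting an edge, every vertex is still connected to a terminal. -/
lemma IsSeriesParallel.surplus_deleteEdge_empty (h : G.IsSeriesParallel) (e : β) :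
    (G.deleteEdge e).surplus ∅ = 0 := by
  classical
  induction h with
  | edge h => exact surplus_eq_zero_of_vertexSet_subset (by exact h.vertexSet.subset)
  | @series A B G hA hB h ihA ihB =>
    rw [(h.deleteEdge e).surplus (hA.isProper.deleteEdge e) (hB.isProper.deleteEdge e), ihA, ihB]
    rcases h.2.2.2.2.notMem_or_notMem e with he | he
    · simp [deleteEdge_of_notMem he, hA.isTidy.linked]
    · simp [deleteEdge_of_notMem he, hB.isTidy.linked]
  | @parallel A B G hA hB h ihA ihB =>
    rw [(h.deleteEdge e).surplus (hA.isProper.deleteEdge e) (hB.isProper.deleteEdge e), ihA, ihB,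
      add_zero]

end TwoTerminalGraph

namespace Graph

variable {α β : Type*} {Γ : Graph α β} {S : Set α} {e : β}

/-! ### Violations of toughness -/

lemma excess_deleteEdges_of_mem {x y : α} (h : Γ.IsLink e x y) (hx : x ∈ S) :
    (Γ.deleteEdges {e}).excess S = Γ.excess S := by
  have : (Γ.deleteEdges {e}).deleteVerts S = Γ.deleteVerts S := by
    refine Graph.ext rfl fun f u v => ?_
    simp only [deleteVerts_isLink, deleteEdges_isLink, Set.mem_singleton_iff]
    constructor
    · tauto
    · rintro ⟨h1, h2, h3⟩
      refine ⟨⟨h1, ?_⟩, h2, h3⟩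
      rintro rfl
      rcases h1.eq_and_eq_or_eq_and_eq h with ⟨rfl, -⟩ | ⟨-, rfl⟩ <;> contradiction
  rw [excess, excess, this]
  rfl

/-- `Γ` satisfies the toughness inequality for `1/2`, for all sets that meet `V(Γ)`. For such a set
the inequality is automatic if at most one component is left, so for connected `Γ` this says that
`Γ` is `1/2`-tough. -/
def HalfTough (Γ : Graph α β) : Prop := ∀ S : Set α, (∃ x ∈ V(Γ), x ∈ S) → Γ.excess S ≤ 0

/-- `S` shows that `Γ` is not `1/2`-tough: `Γ - S` has more than `2 |S|` components, and more than
one. -/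
def IsViolation (Γ : Graph α β) (S : Set α) : Prop :=
  1 ≤ Γ.excess S ∧ ((∀ x ∈ V(Γ), x ∉ S) → 2 ≤ Γ.excess S)

/-- Deleting any edge of `Γ` destroys `1/2`-toughness. -/
def EveryEdgeCritical (Γ : Graph α β) : Prop :=
  ∀ e ∈ E(Γ), ∃ S : Set α, (Γ.deleteEdges {e}).IsViolation S

/-- A set showing that an edge is critical contains no end of that edge: otherwise deleting the edge
would make no difference. -/
lemma IsViolation.notMem (hΓ : Γ.HalfTough) (h : (Γ.deleteEdges {e}).IsViolation S) {x y : α}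
    (he : Γ.IsLink e x y) : x ∉ S := fun hx => by
  have h1 := excess_deleteEdges_of_mem he hx
  have h2 := hΓ S ⟨x, he.left_mem, hx⟩
  have := h.1
  omega

end Graph

namespace TwoTerminalGraph

variable {α β : Type*} {G H A B X K J M : TwoTerminalGraph α β} {S T : Set α} {e : β}

/-! ### Bounds on the surplus -/

/-- The surplus is at most `c` for all sets of inner vertices except the empty one. -/
def InnerBound (G : TwoTerminalGraph α β) (c : ℤ) : Prop :=
  ∀ T : Set α, G.source ∉ T → G.target ∉ T → (∃ x ∈ V(G.graph), x ∈ T) → G.surplus T ≤ c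

lemma InnerBound.rev {c : ℤ} (h : G.InnerBound c) : G.rev.InnerBound c :=
  fun T hs ht hT => by rw [surplus_rev]; exact h T ht hs hT

lemma InnerBound.le_or_eq {c : ℤ} (h : G.InnerBound c) (hG : G.surplus ∅ = 0)
    (hs : G.source ∉ T) (ht : G.target ∉ T) :
    G.surplus T ≤ c ∨ G.surplus T = 0 ∧ ∀ x ∈ V(G.graph), x ∉ T := by
  by_cases hT : ∃ x ∈ V(G.graph), x ∈ T
  · exact .inl (h T hs ht hT)
  · push Not at hT
    exact .inr ⟨by rw [surplus_eq_of_avoids hT, hG], hT⟩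

lemma InnerBound.le_or_linked {c : ℤ} (h : G.InnerBound c) (hG : G.IsTidy)
    (hs : G.source ∉ T) (ht : G.target ∉ T) :
    G.surplus T ≤ c ∨ G.surplus T = 0 ∧ G.Linked T := by
  refine (h.le_or_eq hG.surplus_empty hs ht).imp_right fun h => ⟨h.1, ?_⟩
  exact (linked_iff_of_avoids h.2).2 hG.linked

lemma IsParallelJoin₂.innerBound_left (h : IsParallelJoin₂ A B G) (hA : A.IsProper)
    (hB : B.IsProper) (hB₀ : B.surplus ∅ = 0) {c : ℤ} (hG : G.InnerBound c) :
    A.InnerBound c := by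
  intro T hs ht ⟨x, hx, hxT⟩
  rw [h.1] at hs
  rw [h.2.2.1] at ht
  obtain ⟨U, hs', ht', h1, h2, h3⟩ := h.exists_glue hA hB (T₁ := T) (T₂ := ∅) (by simpa) (by simpa)
  have := hG U (by rwa [hs']) (by rwa [ht'])
    ⟨x, by rw [h.2.2.2.2.2.2.1]; exact .inl hx, by rwa [h1 x hx]⟩
  omega

lemma IsSeriesJoin₂.innerBound_left (h : IsSeriesJoin₂ A B G) (hA : A.IsProper)
    (hB : B.IsProper) (hB₀ : B.surplus ∅ = 0) {c : ℤ} (hG : G.InnerBound c) :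
    A.InnerBound c := by
  classical
  intro T hs ht ⟨x, hx, hxT⟩
  obtain ⟨U, hs', ht', h1, h2, h3⟩ := h.exists_glue hA hB (T₁ := T) (T₂ := ∅) (by simpa)
  have := hG U (by rwa [h.1, hs']) (by rw [h.2.2.1, ht']; simp)
    ⟨x, by rw [h.2.2.2.2.2.1]; exact .inl hx, by rwa [h1 x hx]⟩
  rw [if_neg ht] at h3
  split_ifs at h3 <;> omega

lemma IsSeriesJoin₂.innerBound_right (h : IsSeriesJoin₂ A B G) (hA : A.IsProper)
    (hB : B.IsProper) (hA₀ : A.surplus ∅ = 0) {c : ℤ} (hG : G.InnerBound c) :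
    B.InnerBound c :=
  (h.rev.innerBound_left hB.rev hA.rev (by simpa) hG.rev).rev

/-- Bounds for the surplus which hold for the parts of a minimally `1/2`-tough graph. They are
inherited by series joins. -/
structure IsSmall (G : TwoTerminalGraph α β) : Prop where
  both : ∀ T : Set α, G.source ∈ T → G.target ∈ T → G.surplus T ≤ 2
  source : ∀ T : Set α, G.source ∈ T → G.target ∉ T → G.surplus T ≤ 0
  target : ∀ T : Set α, G.source ∉ T → G.target ∈ T → G.surplus T ≤ 0
  inner : G.InnerBound (-2)

lemma IsSmall.rev (h : G.IsSmall) : G.rev.IsSmall where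
  both T h1 h2 := by rw [surplus_rev]; exact h.both T h2 h1
  source T h1 h2 := by rw [surplus_rev]; exact h.target T h2 h1
  target T h1 h2 := by rw [surplus_rev]; exact h.source T h2 h1
  inner := h.inner.rev

lemma IsSingleEdge.isSmall (h : G.IsSingleEdge) : G.IsSmall where
  both T _ _ := by rw [h.surplus]; norm_num
  source T _ _ := by rw [h.surplus]
  target T _ _ := by rw [h.surplus]
  inner := by
    rintro T hs ht ⟨x, hx, hxT⟩
    rw [h.vertexSet] at hx
    rcases hx with rfl | rfl <;> contradiction

lemma IsSeriesJoin₂.isSmall (h : IsSeriesJoin₂ A B G) (hA : A.IsTidy) (hB : B.IsTidy)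
    (hA' : A.IsSmall) (hB' : B.IsSmall) : G.IsSmall := by
  classical
  have hs := h.surplus hA.toIsProper hB.toIsProper
  have hV := h.2.2.2.2.2.1
  obtain ⟨h1, h2, h3, -, -⟩ := h
  have a1 := hA'.both
  have a2 := hA'.source
  have a3 := hA'.target
  have a4 := fun T h1 h2 => hA'.inner.le_or_linked (T := T) hA h1 h2
  have b1 := hB'.both
  have b2 := hB'.source
  have b3 := hB'.target
  have b4 := fun T h1 h2 => hB'.inner.le_or_linked (T := T) hB h1 h2
  rw [← h2] at b1 b2 b3 b4
  refine ⟨?_, ?_, ?_, ?_⟩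
  · intro T hT hT'
    rw [h1] at hT
    rw [h3] at hT'
    rw [hs]
    grind
  · intro T hT hT'
    rw [h1] at hT
    rw [h3] at hT'
    rw [hs]
    grind
  · intro T hT hT'
    rw [h1] at hT
    rw [h3] at hT'
    rw [hs]
    grind
  · intro T hT hT' ⟨x, hx, hxT⟩
    rw [h1] at hT
    rw [h3] at hT'
    rw [hs]
    rw [hV] at hx
    by_cases hm : A.target ∈ T
    · have := a3 T hT hm
      have := b2 T hm hT'
      rw [if_pos hm]
      omega
    · have a5 := a4 T hT hm
      have b5 := b4 T hm hT'
      rw [if_neg hm]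
      rcases hx with hx | hx
      · have a6 := hA'.inner T hT hm ⟨x, hx, hxT⟩
        split_ifs with hl
        · omega
        · rcases b5 with b5 | b5
          · omega
          · exact absurd (.inr b5.2) hl
      · have b6 := hB'.inner T (h2 ▸ hm) hT' ⟨x, hx, hxT⟩
        split_ifs with hl
        · omega
        · rcases a5 with a5 | a5
          · omega
          · exact absurd (.inl a5.2) hl

lemma IsParallelJoin₂.isSmall (h : IsParallelJoin₂ A B G) (hA : A.IsTidy) (hB : B.IsTidy)
    (hA' : A.IsSmall) (hB' : B.IsSmall)
    (hG : ∀ T : Set α, G.source ∈ T → G.target ∈ T → G.surplus T ≤ 2) : G.IsSmall := by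
  have hs := h.surplus hA.toIsProper hB.toIsProper
  have hV := h.2.2.2.2.2.2.1
  obtain ⟨h1, h2, h3, h4, -, -⟩ := h
  refine ⟨hG, ?_, ?_, ?_⟩
  · intro T hT hT'
    rw [hs]
    have := hA'.source T (by rwa [h1]) (by rwa [h3])
    have := hB'.source T (by rwa [h2]) (by rwa [h4])
    omega
  · intro T hT hT'
    rw [hs]
    have := hA'.target T (by rwa [h1]) (by rwa [h3])
    have := hB'.target T (by rwa [h2]) (by rwa [h4])
    omega
  · intro T hT hT' ⟨x, hx, hxT⟩
    rw [hs]
    have a := hA'.inner.le_or_linked (T := T) hA (by rwa [h1]) (by rwa [h3])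
    have b := hB'.inner.le_or_linked (T := T) hB (by rwa [h2]) (by rwa [h4])
    rw [hV] at hx
    rcases hx with hx | hx
    · have := hA'.inner T (by rwa [h1]) (by rwa [h3]) ⟨x, hx, hxT⟩
      omega
    · have := hB'.inner T (by rwa [h2]) (by rwa [h4]) ⟨x, hx, hxT⟩
      omega

/-! ### Uncrossing -/

/-- A set that contains only the source and a set that contains only the target can be traded for
one set containing both terminals. -/
def Uncrosses (G : TwoTerminalGraph α β) : Prop :=
  ∀ T₁ T₂ : Set α, G.source ∈ T₁ → G.target ∉ T₁ → G.source ∉ T₂ → G.target ∈ T₂ →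
    ∃ T : Set α, G.source ∈ T ∧ G.target ∈ T ∧ G.surplus T₁ + G.surplus T₂ ≤ G.surplus T

lemma Uncrosses.rev (h : G.Uncrosses) : G.rev.Uncrosses := by
  intro T₁ T₂ h1 h2 h3 h4
  obtain ⟨T, hs, ht, hT⟩ := h T₂ T₁ h4 h3 h2 h1
  refine ⟨T, ht, hs, ?_⟩
  simp only [surplus_rev]
  omega

lemma IsParallelJoin₂.uncrosses (h : IsParallelJoin₂ A B G) (hA : A.IsProper) (hB : B.IsProper)
    (hA' : A.Uncrosses) (hB' : B.Uncrosses) : G.Uncrosses := by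
  intro T₁ T₂ h1 h2 h3 h4
  obtain ⟨TA, hsA, htA, hTA⟩ := hA' T₁ T₂ (by rwa [h.1]) (by rwa [h.2.2.1]) (by rwa [h.1])
    (by rwa [h.2.2.1])
  obtain ⟨TB, hsB, htB, hTB⟩ := hB' T₁ T₂ (by rwa [h.2.1]) (by rwa [h.2.2.2.1]) (by rwa [h.2.1])
    (by rwa [h.2.2.2.1])
  rw [h.1] at hsA
  rw [h.2.1] at hsB
  rw [h.2.2.1] at htA
  rw [h.2.2.2.1] at htB
  obtain ⟨T, hs, ht, -, -, hT⟩ := h.exists_glue hA hB (T₁ := TA) (T₂ := TB) (by tauto) (by tauto)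
  refine ⟨T, hs.2 hsA, ht.2 htA, ?_⟩
  rw [h.surplus hA hB T₁, h.surplus hA hB T₂, hT]
  omega

/-- Uncrossing passes to series joins. The bound on inner sets makes sure that a set loses nothing
when it is emptied on a part where it contains no terminal. -/
lemma IsSeriesJoin₂.uncrosses (h : IsSeriesJoin₂ A B G) (hA : A.IsTidy) (hB : B.IsTidy)
    (hG : G.InnerBound (-1)) (hA' : A.Uncrosses) (hB' : B.Uncrosses) : G.Uncrosses := by
  classical
  intro T₁ T₂ h1 h2 h3 h4
  have hiA := h.innerBound_left hA.toIsProper hB.toIsProper hB.surplus_empty hG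
  have hiB := h.innerBound_right hA.toIsProper hB.toIsProper hA.surplus_empty hG
  have hmV : A.target ∈ V(G.graph) := by rw [h.2.2.2.2.2.1]; exact .inl hA.target_mem
  have e1 := h.surplus hA.toIsProper hB.toIsProper T₁
  have e2 := h.surplus hA.toIsProper hB.toIsProper T₂
  have hmB := h.2.1
  have hgl := fun T₁ T₂ h' => h.exists_glue (T₁ := T₁) (T₂ := T₂) hA.toIsProper hB.toIsProper h'
  rw [h.1] at h1 h3 ⊢
  rw [h.2.2.1] at h2 h4 ⊢
  have lA1 : ¬ A.Linked T₁ := fun hl => hl.source_notMem h1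
  have lB2 : ¬ B.Linked T₂ := fun hl => hl.target_notMem h4
  by_cases m1 : A.target ∈ T₁ <;> by_cases m2 : A.target ∈ T₂
  · -- the intersection separates the terminals, so it has negative surplus
    obtain ⟨T, hs, ht, -, -, hT⟩ := hgl T₁ T₂ (by tauto)
    obtain ⟨T', hs', ht', hT₁', -, hT'⟩ := hgl T₂ T₁ (by tauto)
    have := hG T' (by rw [h.1]; tauto) (by rw [h.2.2.1]; tauto)
      ⟨A.target, hmV, (hT₁' _ hA.target_mem).2 m2⟩
    refine ⟨T, hs.2 h1, ht.2 h4, ?_⟩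
    simp only [m1, m2, if_true] at *
    omega
  · -- the middle vertex lies in `T₁` only: uncross inside `B`
    obtain ⟨T₃, hs₃, ht₃, hT₃⟩ := hB' T₁ T₂ (hmB ▸ m1) h2 (hmB ▸ m2) h4
    rw [← hmB] at hs₃
    obtain ⟨T, hs, ht, -, -, hT⟩ := hgl T₁ T₃ (by tauto)
    refine ⟨T, hs.2 h1, ht.2 ht₃, ?_⟩
    have := hiA.le_or_linked hA h3 m2
    grind
  · -- the middle vertex lies in `T₂` only: uncross inside `A`
    obtain ⟨T₃, hs₃, ht₃, hT₃⟩ := hA' T₁ T₂ h1 m1 h3 m2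
    obtain ⟨T, hs, ht, -, -, hT⟩ := hgl T₃ T₂ (by tauto)
    refine ⟨T, hs.2 hs₃, ht.2 h4, ?_⟩
    have := hiB.le_or_linked hB (hmB ▸ m1) h2
    grind
  · obtain ⟨T, hs, ht, -, -, hT⟩ := hgl T₁ T₂ (by tauto)
    refine ⟨T, hs.2 h1, ht.2 h4, ?_⟩
    have := hiA.le_or_linked hA h3 m2
    have := hiB.le_or_linked hB (hmB ▸ m1) h2
    grind

lemma IsSeriesParallel.uncrosses (h : G.IsSeriesParallel) (hG : G.InnerBound (-1)) :
    G.Uncrosses := by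
  induction h with
  | @edge G h =>
    intro T₁ T₂ _ _ _ _
    exact ⟨{G.source, G.target}, by simp, by simp, by simp [h.surplus]⟩
  | @series A B G hA hB h ihA ihB =>
    exact h.uncrosses hA.isTidy hB.isTidy hG
      (ihA (h.innerBound_left hA.isProper hB.isProper hB.isTidy.surplus_empty hG))
      (ihB (h.innerBound_right hA.isProper hB.isProper hA.isTidy.surplus_empty hG))
  | @parallel A B G hA hB h ihA ihB =>
    exact h.uncrosses hA.isProper hB.isProper
      (ihA (h.innerBound_left hA.isProper hB.isProper hB.isTidy.surplus_empty hG))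
      (ihB (h.symm.innerBound_left hB.isProper hA.isProper hA.isTidy.surplus_empty hG))

/-! ### Consequences of toughness -/

/-- Inside a `1/2`-tough graph, a context has negative surplus for all sets of inner vertices other
than the empty one, because the connected part `X` links its terminals. -/
lemma IsParallelJoin₂.innerBound_of_halfTough (h : IsParallelJoin₂ X K G) (hX : X.IsTidy)
    (hK : K.IsProper) (hG : G.graph.HalfTough) : K.InnerBound (-1) := by
  classical
  intro T hs ht ⟨x, hx, hxT⟩
  rw [h.2.1] at hs
  rw [h.2.2.2.1] at ht
  obtain ⟨S, hs', ht', h1, h2, h3⟩ := h.exists_glue hX.toIsProper hK (T₁ := ∅) (T₂ := T)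
    (by simpa) (by simpa)
  have hl : G.Linked S := (h.linked hX.toIsProper hK S).2 (.inl ((linked_congr h1).2 hX.linked))
  have e1 := hG S ⟨x, by rw [h.2.2.2.2.2.2.1]; exact .inr hx, by rwa [h2 x hx]⟩
  rw [excess_of_notMem_of_notMem (h.isProper hX.toIsProper hK) (by simp [hs']) (by simp [ht']),
    if_pos hl, h3, hX.surplus_empty] at e1
  omega

lemma IsParallelJoin₂.surplus_le_one (h : IsParallelJoin₂ X K G) (hX : X.IsProper)
    (hK : K.IsProper) (hG : G.graph.HalfTough) (hs : K.source ∉ T) (ht : K.target ∈ T) :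
    K.surplus T ≤ 1 := by
  rw [h.2.1] at hs
  rw [h.2.2.2.1] at ht
  have hp := h.isProper hX hK
  obtain ⟨S, hs', ht', h1, h2, h3⟩ := h.exists_glue hX hK (T₁ := {G.target}) (T₂ := T)
    (by simpa [hs] using hp.ne) (by simpa)
  rw [← h2 _ (h.2.1 ▸ hK.source_mem)] at hs
  rw [← h2 _ (h.2.2.2.1 ▸ hK.target_mem)] at ht
  have e1 := hG S ⟨_, hp.target_mem, ht⟩
  have e2 : 0 ≤ X.surplus {G.target} := surplus_nonneg_of_subset (by simp [h.2.2.1])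
  rw [excess_of_notMem_of_mem hp hs ht, h3] at e1
  omega

/-! ### Regrouping joins -/

lemma exists_isEdgeDisjointUnion {A B : Graph α β} (h : Disjoint E(A) E(B)) :
    ∃ U : Graph α β, IsEdgeDisjointUnion A B U := by
  have hd : ∀ {e x y z w}, A.IsLink e x y → B.IsLink e z w → False := fun h1 h2 =>
    Set.disjoint_left.1 h h1.edge_mem h2.edge_mem
  refine ⟨{ vertexSet := V(A) ∪ V(B)
            IsLink := fun e x y => A.IsLink e x y ∨ B.IsLink e x y
            isLink_symm := fun e _ => ⟨fun x y h => h.imp .symm .symm⟩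
            eq_or_eq_of_isLink_of_isLink := ?_
            left_mem_of_isLink := ?_ }, h, rfl, fun _ _ _ => Iff.rfl⟩
  · rintro e x y z w (h1 | h1) (h2 | h2)
    · exact h1.left_eq_or_eq h2
    · exact (hd h1 h2).elim
    · exact (hd h2 h1).elim
    · exact h1.left_eq_or_eq h2
  · rintro e x y (h1 | h1)
    · exact .inl h1.left_mem
    · exact .inr h1.left_mem

lemma IsEdgeDisjointUnion.assoc {A B X K G : Graph α β} (h : IsEdgeDisjointUnion A B X)
    (h' : IsEdgeDisjointUnion X K G) :
    ∃ U, IsEdgeDisjointUnion B K U ∧ IsEdgeDisjointUnion A U G := by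
  have hE := h.edgeSet
  have hd := h'.1
  rw [hE, Set.disjoint_union_left] at hd
  obtain ⟨U, hU⟩ := exists_isEdgeDisjointUnion hd.2
  refine ⟨U, hU, ?_, ?_, fun e x y => ?_⟩
  · rw [hU.edgeSet]
    exact Set.disjoint_union_right.2 ⟨h.1, hd.1⟩
  · rw [h'.2.1, h.2.1, hU.2.1, Set.union_assoc]
  · rw [h'.2.2, h.2.2, hU.2.2, or_assoc]

lemma IsParallelJoin₂.assoc (h : IsParallelJoin₂ A B X) (h' : IsParallelJoin₂ X K G)
    (hA : A.IsProper) :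
    ∃ K', IsParallelJoin₂ B K K' ∧ IsParallelJoin₂ A K' G := by
  obtain ⟨h1, h2, h3, h4, h5, h6⟩ := h
  obtain ⟨k1, k2, k3, k4, k5, k6⟩ := h'
  obtain ⟨U, hU, hU'⟩ := h6.assoc k6
  have hs := hA.source_mem
  have ht := hA.target_mem
  rw [k1] at h1 h2 h5
  rw [k3] at h3 h4 h5
  rw [h1] at hs
  rw [h3] at ht
  have hX := h6.2.1
  refine ⟨⟨U, G.source, G.target⟩, ⟨h2, k2, h4, k4, ?_, hU⟩, ⟨h1, rfl, h3, rfl, ?_, hU'⟩⟩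
  · have hsB : G.source ∈ V(A.graph) ∩ V(B.graph) := by simp [h5]
    have htB : G.target ∈ V(A.graph) ∩ V(B.graph) := by simp [h5]
    refine Set.Subset.antisymm ?_ ?_
    · rw [← k5, hX]
      exact Set.inter_subset_inter_left _ Set.subset_union_right
    · have : {G.source, G.target} ⊆ V(K.graph) := k5 ▸ Set.inter_subset_right
      rintro x (rfl | rfl)
      · exact ⟨hsB.2, this (by simp)⟩
      · exact ⟨htB.2, this (by simp)⟩
  · rw [hU.2.1, Set.inter_union_distrib_left, h5, Set.union_eq_left, ← k5, hX]
    exact Set.inter_subset_inter_left _ Set.subset_union_left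

/-- If `G` is the parallel join of a series join of `A` and `B` with `K`, then `G` is also the
parallel join of `A` with the series join of `K` and the reverse of `B`. -/
lemma IsSeriesJoin₂.exists_context (h : IsSeriesJoin₂ A B X) (h' : IsParallelJoin₂ X K G)
    (hA : A.IsProper) (hB : B.IsProper) :
    ∃ K' G', G'.graph = G.graph ∧ IsSeriesJoin₂ K B.rev K' ∧ IsParallelJoin₂ A K' G' := by
  have hs := h.source_notMem hA
  have ht := h.target_notMem hB
  obtain ⟨h1, h2, h3, h4, h5⟩ := h
  obtain ⟨k1, k2, k3, k4, k5, k6⟩ := h'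
  obtain ⟨U, hU, hU'⟩ := h5.assoc k6
  have hX := h5.2.1
  rw [← k1, ← k3, h1, h3] at k5
  have hk : ∀ x, (x ∈ V(A.graph) ∨ x ∈ V(B.graph)) ∧ x ∈ V(K.graph) ↔
      x = A.source ∨ x = B.target := fun x => by
    have := congrArg (x ∈ ·) k5
    simpa [hX] using this
  have hm : ∀ x, x ∈ V(A.graph) ∧ x ∈ V(B.graph) ↔ x = A.target := fun x => by
    have := congrArg (x ∈ ·) h4
    simpa using this
  refine ⟨⟨U, A.source, A.target⟩, ⟨G.graph, A.source, A.target⟩, rfl,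
    ⟨?_, ?_, h2, ?_, hU.symm⟩, ⟨rfl, rfl, rfl, rfl, ?_, hU'⟩⟩
  · change A.source = K.source
    rw [k2, ← k1, h1]
  · change K.target = B.target
    rw [k4, ← k3, h3]
  · have e : K.target = B.target := by rw [k4, ← k3, h3]
    ext x
    simp only [rev_graph, Set.mem_inter_iff, Set.mem_singleton_iff, e]
    have := hk x
    constructor
    · rintro ⟨h6, h7⟩
      rcases this.1 ⟨.inr h7, h6⟩ with rfl | rfl
      · contradiction
      · rfl
    · rintro rfl
      exact ⟨(this.2 (.inr rfl)).2, hB.target_mem⟩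
  · ext x
    simp only [hU.2.1, Set.mem_inter_iff, Set.mem_union, Set.mem_insert_iff,
      Set.mem_singleton_iff]
    have e1 := hk x
    have e2 := hm x
    constructor
    · rintro ⟨h6, h7 | h7⟩
      · exact .inr (e2.1 ⟨h6, h7⟩)
      · rcases e1.1 ⟨.inl h6, h7⟩ with rfl | rfl
        · exact .inl rfl
        · contradiction
    · rintro (rfl | rfl)
      · exact ⟨hA.source_mem, .inr (e1.2 (.inl rfl)).2⟩
      · exact ⟨hA.target_mem, .inl (e2.2 rfl).2⟩

lemma IsSeriesJoin₂.assoc (h : IsSeriesJoin₂ A H X) (h' : IsSeriesJoin₂ X B G)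
    (hH : H.IsProper) :
    ∃ H', IsSeriesJoin₂ H B H' ∧ IsSeriesJoin₂ A H' G := by
  have ht := h.target_notMem hH
  obtain ⟨h1, h2, h3, h4, h5⟩ := h
  obtain ⟨k1, k2, k3, k4, k5⟩ := h'
  obtain ⟨U, hU, hU'⟩ := h5.assoc k5
  have hX := h5.2.1
  rw [h3] at k4
  have hk : ∀ x, (x ∈ V(A.graph) ∨ x ∈ V(H.graph)) ∧ x ∈ V(B.graph) ↔ x = H.target := fun x => by
    have := congrArg (x ∈ ·) k4
    simpa [hX] using this
  refine ⟨⟨U, H.source, B.target⟩, ⟨rfl, by rw [← h3, k2], rfl, ?_, hU⟩,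
    ⟨by rw [k1, h1], h2, k3, ?_, hU'⟩⟩
  · ext x
    have := hk x
    simp only [Set.mem_inter_iff, Set.mem_singleton_iff]
    constructor
    · tauto
    · rintro rfl
      exact ⟨hH.target_mem, by tauto⟩
  · rw [hU.2.1, Set.inter_union_distrib_left, h4, Set.union_eq_left]
    rintro x ⟨hx, hx'⟩
    obtain rfl := (hk x).1 ⟨.inl hx, hx'⟩
    contradiction

lemma IsSeriesJoin.isProper {L : List (TwoTerminalGraph α β)} (h : IsSeriesJoin L G)
    (hL : ∀ X ∈ L, X.IsProper) : G.IsProper := by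
  induction h with
  | single G => exact hL _ (by simp)
  | cons _ h ih => exact h.isProper (hL _ (by simp)) (ih fun X hX => hL _ (by simp [hX]))

lemma IsSeriesJoin.append {L₁ L₂ : List (TwoTerminalGraph α β)} (h₁ : IsSeriesJoin L₁ A)
    (h₂ : IsSeriesJoin L₂ B) (h : IsSeriesJoin₂ A B G) (hL : ∀ X ∈ L₁, X.IsProper) :
    IsSeriesJoin (L₁ ++ L₂) G := by
  induction h₁ generalizing G with
  | single A => exact .cons h₂ h
  | cons hH hj ih =>
    have hL' := fun X hX => hL X (List.mem_cons_of_mem _ hX)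
    obtain ⟨H', h3, h4⟩ := hj.assoc h (hH.isProper hL')
    exact .cons (ih h3 hL') h4

/-! ### Paths -/

lemma IsSeriesJoin.ne_nil {L : List (TwoTerminalGraph α β)} (h : IsSeriesJoin L G) : L ≠ [] := by
  cases h <;> simp

lemma IsSeriesJoin.eq_of_singleton (h : IsSeriesJoin [A] G) : A = G := by
  cases h with
  | single => rfl
  | cons h _ => exact absurd rfl h.ne_nil

lemma IsSeriesJoin.isTidy_isSmall {L : List (TwoTerminalGraph α β)} (h : IsSeriesJoin L G)
    (hL : ∀ X ∈ L, X.IsTidy ∧ X.IsSmall) : G.IsTidy ∧ G.IsSmall := by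
  induction h with
  | single G => exact hL _ (by simp)
  | cons _ h ih =>
    have h1 := hL _ List.mem_cons_self
    have h2 := ih fun X hX => hL _ (by simp [hX])
    exact ⟨h.isTidy h1.1 h2.1, h.isSmall h1.1 h2.1 h1.2 h2.2⟩

lemma IsPathOfLength.isTidy_isSmall {n : ℕ} (h : G.IsPathOfLength n) : G.IsTidy ∧ G.IsSmall := by
  obtain ⟨L, -, hL, h⟩ := h
  exact h.isTidy_isSmall fun X hX => ⟨(hL X hX).isTidy, (hL X hX).isSmall⟩

lemma IsPathOfLength.surplus_le_one {n : ℕ} (h : G.IsPathOfLength n) (hs : G.source ∈ T)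
    (ht : G.target ∈ T) : G.surplus T ≤ 1 := by
  classical
  obtain ⟨L, -, hL, h⟩ := h
  induction h with
  | single G => rw [(hL G (by simp)).surplus]; norm_num
  | @cons A H G L hH h ih =>
    have hA := hL A (by simp)
    have hL' : ∀ X ∈ L, X.IsSingleEdge := fun X hX => hL X (by simp [hX])
    obtain ⟨hHt, hHs⟩ := hH.isTidy_isSmall fun X hX => ⟨(hL' X hX).isTidy, (hL' X hX).isSmall⟩
    rw [h.surplus hA.isProper hHt.toIsProper, hA.surplus]
    rw [h.2.2.1] at ht
    split_ifs with hm hl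
    · have := ih (h.2.1 ▸ hm) ht hL'
      omega
    · have := hHs.target T (h.2.1 ▸ hm) ht
      omega
    · have := hHs.target T (h.2.1 ▸ hm) ht
      omega

lemma IsPathOfLength.append {m n : ℕ} (hA : A.IsPathOfLength m) (hB : B.IsPathOfLength n)
    (h : IsSeriesJoin₂ A B G) : G.IsPathOfLength (m + n) := by
  obtain ⟨L, h1, h2, h3⟩ := hA
  obtain ⟨L', h1', h2', h3'⟩ := hB
  refine ⟨L ++ L', by simp [h1, h1'], fun X hX => ?_,
    h3.append h3' h fun X hX => (h2 X hX).isProper⟩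
  rcases List.mem_append.1 hX with hX | hX
  · exact h2 X hX
  · exact h2' X hX

/-! ### Critical edges -/

lemma IsParallelJoin₂.isLink (h : IsParallelJoin₂ A B G) {x y : α} :
    G.graph.IsLink e x y ↔ A.graph.IsLink e x y ∨ B.graph.IsLink e x y := h.2.2.2.2.2.2.2 e x y

lemma IsSeriesJoin₂.isLink (h : IsSeriesJoin₂ A B G) {x y : α} :
    G.graph.IsLink e x y ↔ A.graph.IsLink e x y ∨ B.graph.IsLink e x y := h.2.2.2.2.2.2 e x y

lemma IsSeriesParallel.exists_isLink_source (h : G.IsSeriesParallel) :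
    ∃ e y, G.graph.IsLink e G.source y := by
  induction h with
  | @edge G h =>
    obtain ⟨-, e, he⟩ := h
    exact ⟨e, G.target, by rw [he]; simp⟩
  | series _ _ h ihA _ =>
    obtain ⟨e, y, he⟩ := ihA
    exact ⟨e, y, h.isLink.2 (.inl (h.1 ▸ he))⟩
  | parallel _ _ h ihA _ =>
    obtain ⟨e, y, he⟩ := ihA
    exact ⟨e, y, h.isLink.2 (.inl (h.1 ▸ he))⟩

lemma IsSeriesParallel.exists_isLink_target (h : G.IsSeriesParallel) :
    ∃ e y, G.graph.IsLink e G.target y := by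
  induction h with
  | @edge G h =>
    obtain ⟨-, e, he⟩ := h
    exact ⟨e, G.source, by rw [he]; simp⟩
  | series _ _ h _ ihB =>
    obtain ⟨e, y, he⟩ := ihB
    exact ⟨e, y, h.isLink.2 (.inr (h.2.2.1 ▸ he))⟩
  | parallel _ _ h ihA _ =>
    obtain ⟨e, y, he⟩ := ihA
    exact ⟨e, y, h.isLink.2 (.inl (h.2.2.1 ▸ he))⟩

/-- If the terminals are not adjacent, then deleting them leaves a component. -/
lemma IsSeriesParallel.one_le_surplus (h : G.IsSeriesParallel)
    (hG : ∀ e, ¬ G.graph.IsLink e G.source G.target) :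
    1 ≤ G.surplus {G.source, G.target} := by
  classical
  induction h with
  | @edge G h =>
    obtain ⟨-, e, he⟩ := h
    exact absurd (by rw [he]; simp) (hG e)
  | @series A B G hA hB h _ _ =>
    have hs := h.source_notMem hA.isProper
    have ht := h.target_notMem hB.isProper
    have hmA : A.target ∉ ({G.source, G.target} : Set α) := by
      simp only [h.1, h.2.2.1, Set.mem_insert_iff, Set.mem_singleton_iff, not_or]
      exact ⟨hA.isProper.ne.symm, fun h' => ht (h' ▸ hA.isProper.target_mem)⟩
    have e1 : A.surplus {G.source, G.target} = A.surplus {A.source} :=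
      surplus_congr fun x hx => by
        simp only [h.1, h.2.2.1, Set.mem_insert_iff, Set.mem_singleton_iff, or_iff_left_iff_imp]
        rintro rfl
        contradiction
    have e2 : B.surplus {G.source, G.target} = B.surplus {B.target} :=
      surplus_congr fun x hx => by
        simp only [h.1, h.2.2.1, Set.mem_insert_iff, Set.mem_singleton_iff, or_iff_right_iff_imp]
        rintro rfl
        contradiction
    have e3 : 0 ≤ A.surplus {A.source} := surplus_nonneg_of_subset (by simp)
    have e4 : 0 ≤ B.surplus {B.target} := surplus_nonneg_of_subset (by simp)
    rw [h.surplus hA.isProper hB.isProper, if_neg hmA, if_neg, e1, e2]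
    · omega
    · rintro (h' | h')
      · exact h'.source_notMem (by simp [h.1])
      · exact h'.target_notMem (by simp [h.2.2.1])
  | @parallel A B G hA hB h ihA _ =>
    have e1 := ihA fun e he => hG e (h.isLink.2 (.inl (h.1 ▸ h.2.2.1 ▸ he)))
    have e2 : 0 ≤ B.surplus {G.source, G.target} :=
      surplus_nonneg_of_subset (by rw [h.2.1, h.2.2.2.1])
    rw [h.1, h.2.2.1] at e1
    rw [h.surplus hA.isProper hB.isProper]
    omega

/-- In a parallel join, a set which shows that an edge at the source is critical contains the
target, but not the source, and it has positive surplus outside of the join. -/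
lemma IsParallelJoin₂.isViolation_of_isLink_left (h : IsParallelJoin₂ A B X)
    (hG : IsParallelJoin₂ X K G) (hA : A.IsSeriesParallel) (hB : B.IsSeriesParallel)
    (hA' : A.IsSmall) (hB' : B.IsSmall) (hK : K.IsProper) (hK₀ : K.surplus ∅ = 0)
    (hΓ : G.graph.HalfTough) {y : α} (he : A.graph.IsLink e X.source y)
    (hS : (G.graph.deleteEdges {e}).IsViolation S) :
    X.source ∉ S ∧ X.target ∈ S ∧ 1 ≤ K.surplus S := by
  classical
  have hX := h.isTidy hA.isTidy hB.isTidy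
  have hKi := hG.innerBound_of_halfTough hX hK hΓ
  have heX : X.graph.IsLink e X.source y := h.isLink.2 (.inl he)
  have hs : X.source ∉ S := hS.notMem hΓ (hG.isLink.2 (.inl heX))
  have hGp := hG.isProper hX.toIsProper hK
  have heB : e ∉ E(B.graph) := fun h' => Set.disjoint_left.1 h.2.2.2.2.2.1 he.edge_mem h'
  have heK : e ∉ E(K.graph) := fun h' => Set.disjoint_left.1 hG.2.2.2.2.2.1 heX.edge_mem h'
  have hd := h.deleteEdge e
  have hGd := hG.deleteEdge e
  rw [deleteEdge_of_notMem heB] at hd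
  rw [deleteEdge_of_notMem heK] at hGd
  have e1 := hd.surplus (hA.isProper.deleteEdge e) hB.isProper S
  have e2 := hGd.surplus (hX.toIsProper.deleteEdge e) hK S
  have e3 := (hA.surplus_deleteEdge_le e S).1
  have hl := hGd.linked (hX.toIsProper.deleteEdge e) hK S
  rw [hd.linked (hA.isProper.deleteEdge e) hB.isProper S] at hl
  have v1 := hS.1
  rw [← deleteEdge_graph] at v1
  refine ⟨hs, ?_⟩
  have a1 := h.1
  have a2 := h.2.1
  have a3 := h.2.2.1
  have a4 := h.2.2.2.1
  by_cases ht : X.target ∈ S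
  · rw [excess_of_notMem_of_mem (hGp.deleteEdge e) (hG.1 ▸ hs) (hG.2.2.1 ▸ ht), e2, e1] at v1
    have := hA'.target S (a1 ▸ hs) (a3 ▸ ht)
    have := hB'.target S (a2 ▸ hs) (a4 ▸ ht)
    exact ⟨ht, by omega⟩
  · exfalso
    have hsG : (G.deleteEdge e).source ∉ S := hG.1 ▸ hs
    have htG : (G.deleteEdge e).target ∉ S := hG.2.2.1 ▸ ht
    have b1 := hA'.inner.le_or_eq hA.isTidy.surplus_empty (a1 ▸ hs) (a3 ▸ ht)
    have b2 := hB'.inner.le_or_eq hB.isTidy.surplus_empty (a2 ▸ hs) (a4 ▸ ht)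
    have b3 := hKi.le_or_eq hK₀ (by rwa [hG.2.1, ← hG.1]) (by rwa [hG.2.2.2.1, ← hG.2.2.1])
    have b1' : (∀ x ∈ V(A.graph), x ∉ S) → (A.deleteEdge e).surplus S = 0 := fun hav => by
      rw [surplus_eq_of_avoids (by exact hav), hA.surplus_deleteEdge_empty]
    have b2' : (∀ x ∈ V(B.graph), x ∉ S) → B.Linked S := fun hav =>
      (linked_iff_of_avoids hav).2 hB.isTidy.linked
    have v2 := hS.2
    rw [← deleteEdge_graph] at v2
    rw [excess_of_notMem_of_notMem (hGp.deleteEdge e) hsG htG, e2, e1] at v1 v2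
    have hav : (∀ x ∈ V(A.graph), x ∉ S) → (∀ x ∈ V(B.graph), x ∉ S) →
        (∀ x ∈ V(K.graph), x ∉ S) → ∀ x ∈ V((G.deleteEdge e).graph), x ∉ S := by
      intro c1 c2 c3 x hx
      have hx' : x ∈ V(G.graph) := hx
      rw [hG.2.2.2.2.2.2.1, h.2.2.2.2.2.2.1] at hx'
      rcases hx' with (hx' | hx') | hx'
      · exact c1 x hx'
      · exact c2 x hx'
      · exact c3 x hx'
    split_ifs at v1 v2 with hl'
    · -- in the last of the eight cases `S` is empty on `G`, which stays connected through `B`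
      rcases b1 with b1 | b1 <;> rcases b2 with b2 | b2 <;> rcases b3 with b3 | b3
      on_goal 8 =>
        have := v2 (hav b1.2 b2.2 b3.2)
        have := b1' b1.2
        omega
      all_goals first | omega | (have := b1' b1.2; omega)
    · have b2'' := b2.resolve_right fun b => hl' (hl.2 (.inl (.inr (b2' b.2))))
      rcases b1 with b1 | b1 <;> rcases b3 with b3 | b3 <;>
        first | omega | (have := b1' b1.2; omega)

lemma IsParallelJoin₂.isViolation_source (h : IsParallelJoin₂ A B X)
    (hG : IsParallelJoin₂ X K G) (hA : A.IsSeriesParallel) (hB : B.IsSeriesParallel)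
    (hA' : A.IsSmall) (hB' : B.IsSmall) (hK : K.IsProper) (hK₀ : K.surplus ∅ = 0)
    (hΓ : G.graph.HalfTough) {y : α} (he : X.graph.IsLink e X.source y)
    (hS : (G.graph.deleteEdges {e}).IsViolation S) :
    X.source ∉ S ∧ X.target ∈ S ∧ 1 ≤ K.surplus S := by
  rcases h.isLink.1 he with he | he
  · exact h.isViolation_of_isLink_left hG hA hB hA' hB' hK hK₀ hΓ he hS
  · exact h.symm.isViolation_of_isLink_left hG hB hA hB' hA' hK hK₀ hΓ he hS

lemma IsSeriesParallel.rev (h : G.IsSeriesParallel) : G.rev.IsSeriesParallel := by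
  induction h with
  | edge h => exact .edge h.rev
  | series _ _ h hA hB => exact .series hB hA h.rev
  | parallel _ _ h hA hB => exact .parallel hA hB h.rev

/-! ### Parts of a minimally tough graph -/

/-- The part `X` of `Γ` has surplus at least `2` for some set containing both terminals, and it has
two edges such that, of the two terminals, every violating set for the first edge contains just the
target, and every violating set for the second edge just the source. -/
structure IsFat (X : TwoTerminalGraph α β) (Γ : Graph α β) : Prop where
  surplus : ∃ T : Set α, X.source ∈ T ∧ X.target ∈ T ∧ 2 ≤ X.surplus T
  source : ∃ e ∈ E(X.graph), ∀ S, (Γ.deleteEdges {e}).IsViolation S → X.source ∉ S ∧ X.target ∈ S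
  target : ∃ e ∈ E(X.graph), ∀ S, (Γ.deleteEdges {e}).IsViolation S → X.source ∈ S ∧ X.target ∉ S

/-- A parallel join of small parts inside a minimally `1/2`-tough graph is small and fat, and its
terminals are not adjacent. Moreover its context `K` has sets of positive surplus that contain just
one terminal, for either terminal; these come from the critical edges at the two terminals. -/
lemma IsParallelJoin₂.isSmall_isFat (h : IsParallelJoin₂ A B X) (hG : IsParallelJoin₂ X K G)
    (hA : A.IsSeriesParallel) (hB : B.IsSeriesParallel)
    (hA' : A.IsSmall) (hB' : B.IsSmall) (hK : K.IsProper) (hK₀ : K.surplus ∅ = 0)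
    (hKu : K.Uncrosses) (hΓ : G.graph.HalfTough) (hc : G.graph.EveryEdgeCritical) :
    X.IsSmall ∧ X.IsFat G.graph ∧ (∀ e, ¬ X.graph.IsLink e X.source X.target) ∧
      (∃ S : Set α, X.source ∉ S ∧ X.target ∈ S ∧ 1 ≤ K.surplus S) ∧
      ∃ S : Set α, X.source ∈ S ∧ X.target ∉ S ∧ 1 ≤ K.surplus S := by
  have hX : X.IsSeriesParallel := .parallel hA hB h
  have hGp := hG.isProper hX.isProper hK
  have key : ∀ {e y S}, X.graph.IsLink e X.source y → (G.graph.deleteEdges {e}).IsViolation S →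
      X.source ∉ S ∧ X.target ∈ S ∧ 1 ≤ K.surplus S := fun he hS =>
    h.isViolation_source hG hA hB hA' hB' hK hK₀ hΓ he hS
  have key' : ∀ {e y S}, X.graph.IsLink e X.target y → (G.graph.deleteEdges {e}).IsViolation S →
      X.source ∈ S ∧ X.target ∉ S ∧ 1 ≤ K.surplus S := by
    intro e y S he hS
    have := h.rev.isViolation_source hG.rev hA.rev hB.rev hA'.rev hB'.rev hK.rev (by simpa) hΓ he hS
    rw [surplus_rev] at this
    exact ⟨this.2.1, this.1, this.2.2⟩
  obtain ⟨e₁, y₁, he₁⟩ := hX.exists_isLink_source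
  obtain ⟨e₂, y₂, he₂⟩ := hX.exists_isLink_target
  have hm₁ : e₁ ∈ E(G.graph) := (hG.isLink.2 (.inl he₁)).edge_mem
  have hm₂ : e₂ ∈ E(G.graph) := (hG.isLink.2 (.inl he₂)).edge_mem
  obtain ⟨S₁, hS₁⟩ := hc e₁ hm₁
  obtain ⟨S₂, hS₂⟩ := hc e₂ hm₂
  have k₁ := key he₁ hS₁
  have k₂ := key' he₂ hS₂
  have hl : ∀ e, ¬ X.graph.IsLink e X.source X.target := by
    intro e he
    obtain ⟨S, hS⟩ := hc e (hG.isLink.2 (.inl he)).edge_mem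
    exact (key' he.symm hS).2.1 (key he hS).2.1
  -- uncrossing the two violating sets outside of `X` gives a set of surplus `2` there, so a set of
  -- surplus `3` on `X` would contradict toughness
  refine ⟨h.isSmall hA.isTidy hB.isTidy hA' hB' ?_, ⟨?_, ⟨e₁, he₁.edge_mem, ?_⟩,
    ⟨e₂, he₂.edge_mem, ?_⟩⟩, hl, ⟨S₁, k₁⟩, ⟨S₂, k₂⟩⟩
  · intro T hs ht
    have a1 := hG.1
    have a2 := hG.2.1
    have a3 := hG.2.2.1
    have a4 := hG.2.2.2.1
    obtain ⟨T₃, hs₃, ht₃, hT₃⟩ := hKu S₂ S₁ (by rw [a2, ← a1]; exact k₂.1)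
      (by rw [a4, ← a3]; exact k₂.2.1) (by rw [a2, ← a1]; exact k₁.1)
      (by rw [a4, ← a3]; exact k₁.2.1)
    rw [a1] at hs
    rw [a3] at ht
    rw [a2] at hs₃
    rw [a4] at ht₃
    obtain ⟨U, hsU, htU, -, -, hU⟩ := hG.exists_glue hX.isProper hK (T₁ := T) (T₂ := T₃)
      (by tauto) (by tauto)
    have e1 := hΓ U ⟨_, hGp.source_mem, hsU.2 hs⟩
    rw [excess_of_mem_of_mem hGp (hsU.2 hs) (htU.2 ht), hU] at e1
    omega
  · refine ⟨{X.source, X.target}, by simp, by simp, ?_⟩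
    have e1 := hA.one_le_surplus fun e he => hl e (h.isLink.2 (.inl (h.1 ▸ h.2.2.1 ▸ he)))
    have e2 := hB.one_le_surplus fun e he => hl e (h.isLink.2 (.inr (h.2.1 ▸ h.2.2.2.1 ▸ he)))
    rw [h.1, h.2.2.1] at e1
    rw [h.2.1, h.2.2.2.1] at e2
    rw [h.surplus hA.isProper hB.isProper]
    omega
  · exact fun S hS => ⟨(key he₁ hS).1, (key he₁ hS).2.1⟩
  · exact fun S hS => ⟨(key' he₂ hS).1, (key' he₂ hS).2.1⟩

/-- If a set which shows that an edge of `A` is critical contains the target of `A`, but not the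
source, then it contains both terminals of the part `B` that follows `A` in series, and its surplus
on `B` is at least `2`: it has to make up for the cost of the middle vertex. -/
lemma IsSeriesJoin₂.two_le_surplus_right (h : IsSeriesJoin₂ A B X) (hG : IsParallelJoin₂ X K G)
    (hA : A.IsSeriesParallel) (hB : B.IsSeriesParallel) (hA' : A.IsSmall) (hB' : B.IsSmall)
    (hK : K.IsTidy) (hΓ : G.graph.HalfTough) (he : e ∈ E(A.graph))
    (hS : (G.graph.deleteEdges {e}).IsViolation S) (hs : A.source ∉ S) (hm : A.target ∈ S) :
    B.target ∈ S ∧ 2 ≤ B.surplus S := by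
  classical
  have hX := h.isTidy hA.isTidy hB.isTidy
  have hKi := hG.innerBound_of_halfTough hX hK.toIsProper hΓ
  have hGp := hG.isProper hX.toIsProper hK.toIsProper
  have heX : e ∈ E(X.graph) := by rw [h.2.2.2.2.edgeSet]; exact .inl he
  have heB : e ∉ E(B.graph) := fun h' => Set.disjoint_left.1 h.2.2.2.2.1 he h'
  have heK : e ∉ E(K.graph) := fun h' => Set.disjoint_left.1 hG.2.2.2.2.2.1 heX h'
  have hd := h.deleteEdge e
  have hGd := hG.deleteEdge e
  rw [deleteEdge_of_notMem heB] at hd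
  rw [deleteEdge_of_notMem heK] at hGd
  have e1 := hd.surplus (hA.isProper.deleteEdge e) hB.isProper S
  rw [deleteEdge_target, if_pos hm] at e1
  have e2 := hGd.surplus (hX.toIsProper.deleteEdge e) hK.toIsProper S
  have e3 := (hA.surplus_deleteEdge_le e S).1
  have e4 := hA'.target S hs hm
  have hl := hGd.linked (hX.toIsProper.deleteEdge e) hK.toIsProper S
  have v1 := hS.1
  rw [← deleteEdge_graph] at v1
  have hsG : G.source ∉ S := by rwa [← hG.1, h.1]
  have hsK : K.source ∉ S := by rwa [hG.2.1]
  by_cases ht : B.target ∈ S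
  · have htG : G.target ∈ S := by rwa [← hG.2.2.1, h.2.2.1]
    rw [excess_of_notMem_of_mem (hGp.deleteEdge e) hsG htG, e2, e1] at v1
    have := hG.surplus_le_one hX.toIsProper hK.toIsProper hΓ hsK (by rwa [hG.2.2.2.1])
    exact ⟨ht, by omega⟩
  · exfalso
    have htG : G.target ∉ S := by rwa [← hG.2.2.1, h.2.2.1]
    rw [excess_of_notMem_of_notMem (hGp.deleteEdge e) hsG htG, e2, e1] at v1
    have b := hB'.source S (h.2.1 ▸ hm) ht
    rcases hKi.le_or_linked hK hsK (by rwa [hG.2.2.2.1]) with k | k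
    · split_ifs at v1 <;> omega
    · rw [if_pos (hl.2 (.inr k.2))] at v1
      omega

lemma IsSeriesJoin₂.two_le_surplus_left (h : IsSeriesJoin₂ A B X) (hG : IsParallelJoin₂ X K G)
    (hA : A.IsSeriesParallel) (hB : B.IsSeriesParallel) (hA' : A.IsSmall) (hB' : B.IsSmall)
    (hK : K.IsTidy) (hΓ : G.graph.HalfTough) (he : e ∈ E(B.graph))
    (hS : (G.graph.deleteEdges {e}).IsViolation S) (hm : B.source ∈ S) (ht : B.target ∉ S) :
    A.source ∈ S ∧ 2 ≤ A.surplus S := by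
  have := h.rev.two_le_surplus_right hG.rev hB.rev hA.rev hB'.rev hA'.rev hK.rev hΓ he hS ht hm
  rwa [surplus_rev] at this

/-- In a minimally `1/2`-tough graph, every series-parallel part whose context connects its
terminals is small, and is either a path or fat. -/
theorem IsSeriesParallel.isSmall_and (hX : X.IsSeriesParallel) :
    ∀ {K G : TwoTerminalGraph α β}, IsParallelJoin₂ X K G → K.IsTidy → K.Uncrosses →
      G.graph.HalfTough → G.graph.EveryEdgeCritical →
      X.IsSmall ∧ ((∃ n, X.IsPathOfLength n) ∨ X.IsFat G.graph) := by
  classical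
  induction hX with
  | @edge X h =>
    intro K G hG hK hKu hΓ hc
    exact ⟨h.isSmall, .inl ⟨1, [X], rfl, by simpa, .single X⟩⟩
  | @series A B X hA hB h ihA ihB =>
    intro K G hG hK hKu hΓ hc
    have hX := h.isTidy hA.isTidy hB.isTidy
    -- the contexts of the two parts
    obtain ⟨KA, GA, hGA, hKA, hA₁⟩ := h.exists_context hG hA.isProper hB.isProper
    obtain ⟨KB, GB, hGB, hKB, hB₁⟩ :=
      h.rev.exists_context hG.rev hB.isProper.rev hA.isProper.rev
    have hKAt := hKA.isTidy hK hB.isTidy.rev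
    have hKBt := hKB.isTidy hK.rev hA.isTidy.rev.rev
    have iKA := hA₁.innerBound_of_halfTough hA.isTidy hKAt.toIsProper (by rwa [hGA])
    have iKB := hB₁.innerBound_of_halfTough hB.isTidy.rev hKBt.toIsProper (by rwa [hGB])
    have iB := (hKA.innerBound_right hK.toIsProper hB.isProper.rev hK.surplus_empty iKA).rev
    have iA := hKB.innerBound_right hK.toIsProper.rev hA.isProper
      (by rw [surplus_rev, hK.surplus_empty]) iKB
    have uA := hA.uncrosses iA
    have uB := hB.uncrosses iB
    obtain ⟨sA, pA⟩ := ihA hA₁ hKAt (hKA.uncrosses hK hB.isTidy.rev iKA hKu uB.rev)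
      (by rwa [hGA]) (by rwa [hGA])
    obtain ⟨sB, pB⟩ := ihB hB₁.rev hKBt.rev
      (hKB.uncrosses hK.rev hA.isTidy iKB hKu.rev uA).rev
      (by rw [rev_graph, hGB]; exact hΓ) (by rw [rev_graph, hGB]; exact hc)
    rw [hGA] at pA
    rw [rev_graph, hGB, rev_graph] at pB
    have hEA : E(A.graph) ⊆ E(G.graph) := by
      rw [hG.2.2.2.2.2.edgeSet, h.2.2.2.2.edgeSet]
      exact Set.subset_union_left.trans Set.subset_union_left
    have hEB : E(B.graph) ⊆ E(G.graph) := by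
      rw [hG.2.2.2.2.2.edgeSet, h.2.2.2.2.edgeSet]
      exact Set.subset_union_right.trans Set.subset_union_left
    refine ⟨h.isSmall hA.isTidy hB.isTidy sA sB, ?_⟩
    -- a fat part forces surplus `2` on the other part, which a path does not have
    have fAB : A.IsFat G.graph → B.IsFat G.graph := by
      intro fA
      obtain ⟨e, he, hv⟩ := fA.source
      obtain ⟨S, hS⟩ := hc e (hEA he)
      obtain ⟨hs, hm⟩ := hv S hS
      obtain ⟨ht, h2⟩ := h.two_le_surplus_right hG hA hB sA sB hK hΓ he hS hs hm
      refine pB.resolve_left ?_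
      rintro ⟨n, hn⟩
      have := hn.surplus_le_one (h.2.1 ▸ hm) ht
      omega
    have fBA : B.IsFat G.graph → A.IsFat G.graph := by
      intro fB
      obtain ⟨e, he, hv⟩ := fB.target
      obtain ⟨S, hS⟩ := hc e (hEB he)
      obtain ⟨hm, ht⟩ := hv S hS
      obtain ⟨hs, h2⟩ := h.two_le_surplus_left hG hA hB sA sB hK hΓ he hS hm ht
      refine pA.resolve_left ?_
      rintro ⟨n, hn⟩
      have := hn.surplus_le_one hs (h.2.1 ▸ hm)
      omega
    by_cases fA : A.IsFat G.graph
    · have fB := fAB fA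
      right
      refine ⟨?_, ?_, ?_⟩
      · obtain ⟨TA, a1, a2, a3⟩ := fA.surplus
        obtain ⟨TB, b1, b2, b3⟩ := fB.surplus
        rw [← h.2.1] at b1
        obtain ⟨T, hs, ht, -, -, hT⟩ := h.exists_glue hA.isProper hB.isProper (T₁ := TA)
          (T₂ := TB) (by tauto)
        rw [if_pos a2] at hT
        exact ⟨T, by rw [h.1]; tauto, by rw [h.2.2.1]; tauto, by omega⟩
      · obtain ⟨e, he, hv⟩ := fA.source
        refine ⟨e, by rw [h.2.2.2.2.edgeSet]; exact .inl he, fun S hS => ?_⟩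
        obtain ⟨hs, hm⟩ := hv S hS
        rw [h.1, h.2.2.1]
        exact ⟨hs, (h.two_le_surplus_right hG hA hB sA sB hK hΓ he hS hs hm).1⟩
      · obtain ⟨e, he, hv⟩ := fB.target
        refine ⟨e, by rw [h.2.2.2.2.edgeSet]; exact .inr he, fun S hS => ?_⟩
        obtain ⟨hm, ht⟩ := hv S hS
        rw [h.1, h.2.2.1]
        exact ⟨(h.two_le_surplus_left hG hA hB sA sB hK hΓ he hS hm ht).1, ht⟩
    · left
      obtain ⟨m, hm⟩ := pA.resolve_right fA
      obtain ⟨n, hn⟩ := pB.resolve_right fun fB => fA (fBA fB)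
      exact ⟨m + n, hm.append hn h⟩
  | @parallel A B X hA hB h ihA ihB =>
    intro K G hG hK hKu hΓ hc
    obtain ⟨KA, hKA, hA₁⟩ := h.assoc hG hA.isProper
    obtain ⟨KB, hKB, hB₁⟩ := h.symm.assoc hG hB.isProper
    have hKAt := hKA.isTidy hB.isTidy hK
    have hKBt := hKB.isTidy hA.isTidy hK
    have uB := hB.uncrosses (hKA.innerBound_left hB.isProper hK.toIsProper hK.surplus_empty
      (hA₁.innerBound_of_halfTough hA.isTidy hKAt.toIsProper hΓ))
    have uA := hA.uncrosses (hKB.innerBound_left hA.isProper hK.toIsProper hK.surplus_empty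
      (hB₁.innerBound_of_halfTough hB.isTidy hKBt.toIsProper hΓ))
    have sA := (ihA hA₁ hKAt (hKA.uncrosses hB.isProper hK.toIsProper uB hKu) hΓ hc).1
    have sB := (ihB hB₁ hKBt (hKB.uncrosses hA.isProper hK.toIsProper uA hKu) hΓ hc).1
    have := h.isSmall_isFat hG hA hB sA sB hK.toIsProper hK.surplus_empty hKu hΓ hc
    exact ⟨this.1, .inr this.2.1⟩

/-! ### Blocks of a minimally tough graph -/

/-- What lies before and after a part of a series join: a graph in which the two terminals are
never linked, and in which the choices of vertices on both sides are independent. -/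
structure IsOuterContext (J : TwoTerminalGraph α β) : Prop extends J.IsProper where
  not_linked : ∀ T, ¬ J.Linked T
  surplus_empty : J.surplus ∅ = 0
  exchange : ∀ T₁ T₂ : Set α, ∃ T₃ T₄ : Set α,
    (J.source ∈ T₃ ↔ J.source ∈ T₁) ∧ (J.target ∈ T₃ ↔ J.target ∈ T₂) ∧
    (J.source ∈ T₄ ↔ J.source ∈ T₂) ∧ (J.target ∈ T₄ ↔ J.target ∈ T₁) ∧
    J.surplus T₁ + J.surplus T₂ ≤ J.surplus T₃ + J.surplus T₄

lemma IsOuterContext.rev (h : J.IsOuterContext) : J.rev.IsOuterContext where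
  toIsProper := h.toIsProper.rev
  not_linked T := by rw [linked_rev]; exact h.not_linked T
  surplus_empty := by rw [surplus_rev, h.surplus_empty]
  exchange T₁ T₂ := by
    obtain ⟨T₃, T₄, h1, h2, h3, h4, h5⟩ := h.exchange T₂ T₁
    refine ⟨T₃, T₄, h2, h1, h4, h3, ?_⟩
    simp only [surplus_rev]
    omega

lemma IsOuterContext.series (hJ : J.IsOuterContext) (hB : B.IsTidy) (h : IsSeriesJoin₂ J B K) :
    K.IsOuterContext where
  toIsProper := h.isProper hJ.toIsProper hB.toIsProper
  not_linked T := by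
    rw [h.linked hJ.toIsProper hB.toIsProper]
    exact fun h => hJ.not_linked T h.1
  surplus_empty := by
    classical
    rw [h.surplus hJ.toIsProper hB.toIsProper, hJ.surplus_empty, hB.surplus_empty]
    simp [hB.linked]
  exchange T₁ T₂ := by
    classical
    obtain ⟨U₃, U₄, h1, h2, h3, h4, h5⟩ := hJ.exchange T₁ T₂
    obtain ⟨T₃, a1, a2, -, -, a3⟩ :=
      h.exists_glue hJ.toIsProper hB.toIsProper (T₁ := U₃) (T₂ := T₂) h2
    obtain ⟨T₄, b1, b2, -, -, b3⟩ :=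
      h.exists_glue hJ.toIsProper hB.toIsProper (T₁ := U₄) (T₂ := T₁) h4
    refine ⟨T₃, T₄, ?_⟩
    rw [h.1, h.2.2.1]
    refine ⟨a1.trans h1, a2, b1.trans h3, b2, ?_⟩
    have e1 := h.surplus hJ.toIsProper hB.toIsProper T₁
    have e2 := h.surplus hJ.toIsProper hB.toIsProper T₂
    simp only [hJ.not_linked, false_or, h2, h4] at a3 b3 e1 e2
    omega

lemma IsOuterContext.uncrosses (h : J.IsOuterContext) (hi : J.InnerBound (-1)) :
    J.Uncrosses := by
  intro T₁ T₂ h1 h2 h3 h4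
  obtain ⟨T₃, T₄, a1, a2, a3, a4, a5⟩ := h.exchange T₁ T₂
  have := hi.le_or_eq h.surplus_empty (T := T₄) (by tauto) (by tauto)
  exact ⟨T₃, by tauto, by tauto, by omega⟩

/-- Nothing is attached at the source: whether a set contains the source does not influence its
surplus. -/
def FreeSource (J : TwoTerminalGraph α β) : Prop :=
  ∀ T, J.surplus (T \ {J.source}) = J.surplus T

lemma FreeSource.series (hJ : J.FreeSource) (hJ' : J.IsOuterContext) (hB : B.IsProper)
    (h : IsSeriesJoin₂ J B K) : K.FreeSource := by
  classical
  intro T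
  have hs := h.source_notMem hJ'.toIsProper
  have hBT : ∀ x ∈ V(B.graph), x ∈ T \ {J.source} ↔ x ∈ T := fun x hx => by
    simp only [Set.mem_sdiff, Set.mem_singleton_iff, and_iff_left_iff_imp]
    rintro - rfl
    contradiction
  have hne := hJ'.ne.symm
  rw [h.surplus hJ'.toIsProper hB, h.surplus hJ'.toIsProper hB, h.1, hJ, surplus_congr hBT]
  simp [hJ'.not_linked, linked_congr hBT, hne]

/-- The context of a whole graph: its two terminals, and no edges. -/
def isolatedTerminals (X : TwoTerminalGraph α β) : TwoTerminalGraph α β :=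
  ⟨Graph.banana X.source X.target ∅, X.source, X.target⟩

lemma surplus_isolatedTerminals (X : TwoTerminalGraph α β) (T : Set α) :
    X.isolatedTerminals.surplus T = 0 :=
  surplus_eq_zero_of_vertexSet_subset subset_rfl

lemma IsProper.isOuterContext_isolatedTerminals (h : X.IsProper) :
    X.isolatedTerminals.IsOuterContext where
  source_mem := by simp [isolatedTerminals]
  target_mem := by simp [isolatedTerminals]
  ne := h.ne
  finite := by simp [isolatedTerminals]
  not_linked T := by
    rintro ⟨-, hT⟩
    rcases Relation.ReflTransGen.cases_head hT with hT | ⟨y, ⟨e, he⟩, -⟩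
    · exact h.ne hT
    · rw [Graph.deleteVerts_isLink] at he
      have := he.1.edge_mem
      simp [isolatedTerminals] at this
  surplus_empty := surplus_isolatedTerminals X _
  exchange T₁ T₂ := by
    have hne := h.ne
    have hne' := h.ne.symm
    refine ⟨{x | x = X.source ∧ x ∈ T₁ ∨ x = X.target ∧ x ∈ T₂},
      {x | x = X.source ∧ x ∈ T₂ ∨ x = X.target ∧ x ∈ T₁}, ?_⟩
    simp only [surplus_isolatedTerminals]
    simp [isolatedTerminals, hne, hne']

lemma freeSource_isolatedTerminals (X : TwoTerminalGraph α β) :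
    X.isolatedTerminals.FreeSource := fun T => by simp only [surplus_isolatedTerminals]

lemma IsProper.isParallelJoin₂_isolatedTerminals (h : X.IsProper) :
    IsParallelJoin₂ X X.isolatedTerminals X := by
  have hV : ({X.source, X.target} : Set α) ⊆ V(X.graph) := by
    rintro x (rfl | rfl)
    exacts [h.source_mem, h.target_mem]
  refine ⟨rfl, rfl, rfl, rfl, ?_, ?_, ?_, fun e x y => ?_⟩
  · exact Set.inter_eq_right.2 hV
  · exact Set.disjoint_empty _
  · exact (Set.union_eq_left.2 hV).symm
  · refine ⟨.inl, fun h => h.resolve_right fun h => ?_⟩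
    have := h.edge_mem
    simp [isolatedTerminals] at this

/-- A parallel join that is a part of a minimally `1/2`-tough series join is a pearl, and something
is attached at its terminals. -/
lemma IsParallelJoin₂.isPearl (h : IsParallelJoin₂ A B X) (hA : A.IsSeriesParallel)
    (hB : B.IsSeriesParallel) (hG : IsParallelJoin₂ X J G) (hJ : J.IsOuterContext)
    (hΓ : G.graph.HalfTough) (hc : G.graph.EveryEdgeCritical) :
    X.IsPearl ∧ ¬ J.FreeSource ∧ ¬ J.rev.FreeSource := by
  have hX : X.IsSeriesParallel := .parallel hA hB h
  have hJi := hG.innerBound_of_halfTough hX.isTidy hJ.toIsProper hΓ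
  have hJu := hJ.uncrosses hJi
  obtain ⟨KA, hKA, hA₁⟩ := h.assoc hG hA.isProper
  obtain ⟨KB, hKB, hB₁⟩ := h.symm.assoc hG hB.isProper
  have tidy : ∀ {B K}, B.IsTidy → IsParallelJoin₂ B J K → K.IsTidy := fun hB h =>
    { toIsProper := h.isProper hB.toIsProper hJ.toIsProper
      linked := (h.linked hB.toIsProper hJ.toIsProper ∅).2 (.inl hB.linked)
      surplus_empty := by
        rw [h.surplus hB.toIsProper hJ.toIsProper, hB.surplus_empty, hJ.surplus_empty, add_zero] }
  have hKAt := tidy hB.isTidy hKA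
  have hKBt := tidy hA.isTidy hKB
  have uB := hB.uncrosses (hKA.innerBound_left hB.isProper hJ.toIsProper hJ.surplus_empty
    (hA₁.innerBound_of_halfTough hA.isTidy hKAt.toIsProper hΓ))
  have uA := hA.uncrosses (hKB.innerBound_left hA.isProper hJ.toIsProper hJ.surplus_empty
    (hB₁.innerBound_of_halfTough hB.isTidy hKBt.toIsProper hΓ))
  obtain ⟨sA, pA⟩ :=
    hA.isSmall_and hA₁ hKAt (hKA.uncrosses hB.isProper hJ.toIsProper uB hJu) hΓ hc
  obtain ⟨sB, pB⟩ :=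
    hB.isSmall_and hB₁ hKBt (hKB.uncrosses hA.isProper hJ.toIsProper uA hJu) hΓ hc
  obtain ⟨sX, -, hl, ⟨S₁, s1, t1, k1⟩, ⟨S₂, s2, t2, k2⟩⟩ :=
    h.isSmall_isFat hG hA hB sA sB hJ.toIsProper hJ.surplus_empty hJu hΓ hc
  have a1 := h.1
  have a2 := h.2.1
  have a3 := h.2.2.1
  have a4 := h.2.2.2.1
  have lA : ∀ e, ¬ A.graph.IsLink e A.source A.target := fun e he =>
    hl e (h.isLink.2 (.inl (a1 ▸ a3 ▸ he)))
  have lB : ∀ e, ¬ B.graph.IsLink e B.source B.target := fun e he =>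
    hl e (h.isLink.2 (.inr (a2 ▸ a4 ▸ he)))
  have hsur := h.surplus hA.isProper hB.isProper
  -- a part with surplus at least `2` would give `X` surplus at least `3`
  have fA : ¬ A.IsFat G.graph := fun fA => by
    obtain ⟨T, hs, ht, hT⟩ := fA.surplus
    have := hB.one_le_surplus lB
    obtain ⟨U, hs', ht', -, -, hU⟩ := h.exists_glue hA.isProper hB.isProper (T₁ := T)
      (T₂ := {B.source, B.target}) (by simp [a1 ▸ hs, a2]) (by simp [a3 ▸ ht, a4])
    have := sX.both U (hs'.2 (a1 ▸ hs)) (ht'.2 (a3 ▸ ht))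
    omega
  have fB : ¬ B.IsFat G.graph := fun fB => by
    obtain ⟨T, hs, ht, hT⟩ := fB.surplus
    have := hA.one_le_surplus lA
    obtain ⟨U, hs', ht', -, -, hU⟩ := h.exists_glue hA.isProper hB.isProper
      (T₁ := {A.source, A.target}) (T₂ := T) (by simp [a2 ▸ hs, a1]) (by simp [a4 ▸ ht, a3])
    have := sX.both U (hs'.2 (by simp [a1])) (ht'.2 (by simp [a3]))
    omega
  have length : ∀ {P : TwoTerminalGraph α β} {n}, P.IsPathOfLength n →
      (∀ e, ¬ P.graph.IsLink e P.source P.target) → 2 ≤ n := by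
    rintro P n ⟨L, hL, hL', hj⟩ hl
    by_contra hn
    match L, hL with
    | [], _ => exact hj.ne_nil rfl
    | [Y], _ =>
      obtain rfl := hj.eq_of_singleton
      obtain ⟨-, e, he⟩ := hL' Y (by simp)
      exact hl e (by rw [he]; simp)
    | _ :: _ :: _, hL => simp at hL; omega
  obtain ⟨m, hm⟩ := pA.resolve_right fA
  obtain ⟨n, hn⟩ := pB.resolve_right fB
  refine ⟨⟨A, B, m, n, length hm lA, length hn lB, hm, hn, h⟩, fun hf => ?_, fun hf => ?_⟩
  · have e2 : J.target = X.target := by rw [hG.2.2.2.1, hG.2.2.1]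
    rw [← hf] at k2
    have := hJi.le_or_eq hJ.surplus_empty (T := S₂ \ {J.source}) (by simp)
      (fun h => t2 (e2 ▸ h.1))
    omega
  · have e1 : J.source = X.source := by rw [hG.2.1, hG.1]
    have e3 := hf S₁
    simp only [surplus_rev, rev_source] at e3
    rw [← e3] at k1
    have := hJi.le_or_eq hJ.surplus_empty (T := S₁ \ {J.target}) (fun h => s1 (e1 ▸ h.1))
      (by simp)
    omega

lemma IsPearl.isTidy_isSmall (h : X.IsPearl) : X.IsTidy ∧ X.IsSmall := by
  obtain ⟨P, Q, m, n, -, -, hP, hQ, h⟩ := h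
  obtain ⟨tP, sP⟩ := hP.isTidy_isSmall
  obtain ⟨tQ, sQ⟩ := hQ.isTidy_isSmall
  refine ⟨h.isTidy tP tQ, h.isSmall tP tQ sP sQ fun T hs ht => ?_⟩
  rw [h.surplus tP.toIsProper tQ.toIsProper]
  have := hP.surplus_le_one (T := T) (by rwa [h.1]) (by rwa [h.2.2.1])
  have := hQ.surplus_le_one (T := T) (by rwa [h.2.1]) (by rwa [h.2.2.2.1])
  omega

lemma IsPearl.isProper (h : X.IsPearl) : X.IsProper := h.isTidy_isSmall.1.toIsProper

/-- A part of a minimally `1/2`-tough series join is a series join of edges and pearls, which starts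
or ends with an edge if nothing is attached there. -/
theorem IsSeriesParallel.exists_isSeriesJoin (hX : X.IsSeriesParallel) :
    ∀ {J G : TwoTerminalGraph α β}, IsParallelJoin₂ X J G → J.IsOuterContext →
      G.graph.HalfTough → G.graph.EveryEdgeCritical →
      ∃ L : List (TwoTerminalGraph α β), IsSeriesJoin L X ∧
        (∀ Y ∈ L, Y.IsSingleEdge ∨ Y.IsPearl) ∧
        (J.FreeSource → ∀ Y ∈ L.head?, Y.IsSingleEdge) ∧
        (J.rev.FreeSource → ∀ Y ∈ L.getLast?, Y.IsSingleEdge) := by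
  induction hX with
  | @edge X h =>
    intro J G hG hJ hΓ hc
    exact ⟨[X], .single X, by simp [h], by simp [h], by simp [h]⟩
  | @series A B X hA hB h ihA ihB =>
    intro J G hG hJ hΓ hc
    obtain ⟨KA, GA, hGA, hKA, hA₁⟩ := h.exists_context hG hA.isProper hB.isProper
    obtain ⟨KB, GB, hGB, hKB, hB₁⟩ :=
      h.rev.exists_context hG.rev hB.isProper.rev hA.isProper.rev
    obtain ⟨L₁, a1, a2, a3, -⟩ := ihA hA₁ (hJ.series hB.isTidy.rev hKA) (by rwa [hGA])
      (by rwa [hGA])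
    obtain ⟨L₂, b1, b2, -, b4⟩ := ihB hB₁.rev (hJ.rev.series hA.isTidy hKB).rev
      (by rw [rev_graph, hGB]; exact hΓ) (by rw [rev_graph, hGB]; exact hc)
    refine ⟨L₁ ++ L₂, a1.append b1 h ?_, ?_, ?_, ?_⟩
    · exact fun Y hY => (a2 Y hY).elim IsSingleEdge.isProper IsPearl.isProper
    · intro Y hY
      rcases List.mem_append.1 hY with hY | hY
      exacts [a2 Y hY, b2 Y hY]
    · intro hf Y hY
      rw [List.head?_append_of_ne_nil _ a1.ne_nil] at hY
      exact a3 (hf.series hJ hB.isProper.rev hKA) Y hY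
    · intro hf Y hY
      rw [List.getLast?_append_of_ne_nil _ b1.ne_nil] at hY
      exact b4 (hf.series hJ.rev hA.isProper hKB) Y hY
  | @parallel A B X hA hB h _ _ =>
    intro J G hG hJ hΓ hc
    obtain ⟨h1, h2, h3⟩ := h.isPearl hA hB hG hJ hΓ hc
    exact ⟨[X], .single X, by simp [h1], fun hf => absurd hf h2, fun hf => absurd hf h3⟩

end TwoTerminalGraph

namespace Graph

variable {α β : Type*} {Γ : Graph α β} {S : Set α}

/-! ### Toughness `1/2` -/

lemma IsTough.le_toughness {t : ℝ} (h : Γ.IsTough t) : (t : EReal) ≤ Γ.toughness :=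
  le_sSup (Set.mem_image_of_mem _ (show t ∈ {t | Γ.IsTough t} from h))

lemma toughness_lt_half_iff : Γ.toughness < ((1 / 2 : ℝ) : EReal) ↔ ¬ Γ.IsTough (1 / 2) := by
  constructor
  · intro h ht
    exact absurd ht.le_toughness (not_le.2 h)
  · intro h
    simp only [IsTough, not_forall, not_le] at h
    obtain ⟨S, hS, hc, hlt⟩ := h
    have hpos : (0 : ℝ) < ((Γ.deleteVerts S).numComponents : ℝ) := by
      exact_mod_cast (zero_lt_one.trans hc)
    refine lt_of_le_of_lt (b := (((S.ncard : ℝ) / (Γ.deleteVerts S).numComponents : ℝ) : EReal))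
      (sSup_le ?_) ?_
    · rintro _ ⟨t, ht, rfl⟩
      exact EReal.coe_le_coe_iff.2 ((le_div_iff₀ hpos).2 (ht S hS hc))
    · exact EReal.coe_lt_coe_iff.2 ((div_lt_iff₀ hpos).2 hlt)

lemma isTough_half_iff : Γ.IsTough (1 / 2) ↔ ∀ S ⊆ V(Γ), 1 < (Γ.deleteVerts S).numComponents →
    Γ.excess S ≤ 0 := by
  refine forall₃_congr fun S hS hc => ?_
  rw [excess, Set.inter_eq_left.2 hS, ← @Int.cast_le ℝ]
  push_cast
  constructor <;> intro h <;> linarith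

lemma excess_inter_vertexSet (Γ : Graph α β) (S : Set α) :
    Γ.excess (S ∩ V(Γ)) = Γ.excess S := by
  rw [excess, excess, deleteVerts_congr (T := S) (by simp +contextual), Set.inter_assoc,
    Set.inter_self]

lemma HalfTough.isTough (h : Γ.HalfTough) (h₀ : Γ.excess ∅ ≤ 1) : Γ.IsTough (1 / 2) := by
  rw [isTough_half_iff]
  intro S hS hc
  rcases S.eq_empty_or_nonempty with rfl | ⟨x, hx⟩
  · simp only [excess, Set.empty_inter, Set.ncard_empty] at h₀
    omega
  · exact h S ⟨x, hS hx, hx⟩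

lemma IsTough.halfTough (h : Γ.IsTough (1 / 2)) (hΓ : V(Γ).Finite) : Γ.HalfTough := by
  rw [isTough_half_iff] at h
  rintro S ⟨x, hx, hxS⟩
  rw [← excess_inter_vertexSet]
  by_cases hc : 1 < (Γ.deleteVerts (S ∩ V(Γ))).numComponents
  · exact h _ Set.inter_subset_right hc
  · have : 0 < (S ∩ V(Γ)).ncard :=
      (Set.ncard_pos (hΓ.inter_of_right _)).2 ⟨x, hxS, hx⟩
    rw [excess, Set.inter_assoc, Set.inter_self]
    omega

lemma exists_isViolation_iff (hΓ : V(Γ).Finite) :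
    (∃ S, Γ.IsViolation S) ↔ ¬ Γ.IsTough (1 / 2) := by
  rw [isTough_half_iff]
  push Not
  constructor
  · rintro ⟨S, h1, h2⟩
    rw [← excess_inter_vertexSet] at h1 h2
    refine ⟨S ∩ V(Γ), Set.inter_subset_right, ?_, by omega⟩
    by_cases hS : ∃ x ∈ V(Γ), x ∈ S
    · obtain ⟨x, hx, hxS⟩ := hS
      have : 0 < (S ∩ V(Γ)).ncard :=
        (Set.ncard_pos (hΓ.inter_of_right _)).2 ⟨x, hxS, hx⟩
      rw [excess, Set.inter_assoc, Set.inter_self] at h1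
      omega
    · push Not at hS
      have := h2 hS
      rw [excess] at this
      omega
  · rintro ⟨S, hS, hc, hlt⟩
    refine ⟨S, by omega, fun h => ?_⟩
    obtain rfl : S = ∅ := Set.eq_empty_of_forall_notMem fun x hx => h x (hS hx) hx
    simp only [excess, Set.empty_inter, Set.ncard_empty]
    omega

lemma IsMinimallyTough.halfTough (h : Γ.IsMinimallyTough (1 / 2)) (hΓ : V(Γ).Finite) :
    Γ.HalfTough := by
  refine IsTough.halfTough (not_not.1 fun ht => ?_) hΓ
  exact (toughness_lt_half_iff.2 ht).ne h.1

lemma IsMinimallyTough.everyEdgeCritical (h : Γ.IsMinimallyTough (1 / 2)) (hΓ : V(Γ).Finite) :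
    Γ.EveryEdgeCritical := fun e he =>
  (exists_isViolation_iff (by exact hΓ)).2 (toughness_lt_half_iff.1 (h.2 e he))

lemma HalfTough.isMinimallyTough (h : Γ.HalfTough) (hΓ : V(Γ).Finite) (h₀ : Γ.excess ∅ ≤ 1)
    (hc : Γ.EveryEdgeCritical) {x : α} (hx : x ∈ V(Γ)) (hx' : Γ.excess {x} = 0) :
    Γ.IsMinimallyTough (1 / 2) := by
  refine ⟨le_antisymm (sSup_le ?_) (h.isTough h₀).le_toughness, fun e he => ?_⟩
  · rintro _ ⟨t, ht, rfl⟩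
    rw [excess, Set.inter_eq_left.2 (Set.singleton_subset_iff.2 hx), Set.ncard_singleton] at hx'
    have hn : (Γ.deleteVerts {x}).numComponents = 2 := by omega
    have := ht {x} (Set.singleton_subset_iff.2 hx) (by omega)
    rw [hn, Set.ncard_singleton] at this
    push_cast at this
    exact EReal.coe_le_coe_iff.2 (by linarith)
  · exact toughness_lt_half_iff.2 ((exists_isViolation_iff (by exact hΓ)).1 (hc e he))

end Graph

namespace TwoTerminalGraph

variable {α β : Type*} {G H A B X K J M : TwoTerminalGraph α β} {S T : Set α} {e : β}

/-! ### Toughness of single edges and of small graphs -/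

lemma IsSingleEdge.not_isMinimallyTough (h : G.IsSingleEdge) :
    ¬ G.graph.IsMinimallyTough (1 / 2) := by
  classical
  intro hm
  have ht : G.graph.IsTough 1 := by
    intro S hS hc
    exfalso
    have e1 := numComponents_eq h.isProper S
    have e2 := h.surplus S
    have e3 : (S ∩ V(G.graph)) \ {G.source, G.target} = ∅ := by
      rw [Set.sdiff_eq_empty, h.vertexSet]
      exact Set.inter_subset_right
    rw [TwoTerminalGraph.surplus, e3, Set.ncard_empty] at e2
    have e4 : G.source ∉ S → G.target ∉ S → G.Linked S := fun h1 h2 =>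
      (linked_iff_of_avoids (by rw [h.vertexSet]; rintro x (rfl | rfl) <;> assumption)).2
        h.isTidy.linked
    by_cases h1 : G.source ∈ S <;> by_cases h2 : G.target ∈ S
    · simp only [h1, h2, not_true, false_and, if_false] at e1
      omega
    · simp only [h1, h2, not_true, not_false_eq_true, false_and, if_false, if_true] at e1
      omega
    · simp only [h1, h2, not_true, if_false] at e1
      split_ifs at e1 <;> omega
    · simp only [h1, h2, e4 h1 h2, not_true, not_false_eq_true, and_false, if_false, if_true] at e1
      omega
  have h2 : ((1 : ℝ) : EReal) ≤ ((1 / 2 : ℝ) : EReal) := ht.le_toughness.trans_eq hm.1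
  rw [EReal.coe_le_coe_iff] at h2
  norm_num at h2

lemma IsTidy.excess_empty (h : G.IsTidy) : G.graph.excess ∅ = 1 := by
  classical
  rw [excess_of_notMem_of_notMem h.toIsProper (Set.notMem_empty _) (Set.notMem_empty _),
    h.surplus_empty, if_pos h.linked]
  rfl

lemma IsSmall.halfTough (h : G.IsSmall) (hG : G.IsProper) : G.graph.HalfTough := by
  classical
  intro S hS
  by_cases hs : G.source ∈ S <;> by_cases ht : G.target ∈ S
  · rw [excess_of_mem_of_mem hG hs ht]
    have := h.both S hs ht
    omega
  · rw [excess_of_mem_of_notMem hG hs ht]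
    have := h.source S hs ht
    omega
  · rw [excess_of_notMem_of_mem hG hs ht]
    have := h.target S hs ht
    omega
  · rw [excess_of_notMem_of_notMem hG hs ht]
    have := h.inner S hs ht hS
    split_ifs <;> omega

/-! ### Critical edges of pearls -/

lemma IsSingleEdge.not_linked_deleteEdge (h : G.IsSingleEdge) (he : e ∈ E(G.graph)) (S : Set α) :
    ¬ (G.deleteEdge e).Linked S := by
  obtain ⟨hne, f, hf⟩ := h
  rintro ⟨-, hT⟩
  rcases Relation.ReflTransGen.cases_head hT with hT | ⟨y, ⟨e', he'⟩, -⟩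
  · exact hne hT
  · rw [Graph.deleteVerts_isLink, deleteEdge_graph, Graph.deleteEdges_isLink] at he'
    have h1 := he'.1.1.edge_mem
    have h2 := he'.1.2
    rw [hf] at h1 he
    simp_all

lemma IsSeriesJoin.isTidy_of_isSingleEdge {L : List (TwoTerminalGraph α β)}
    (h : IsSeriesJoin L G) (hL : ∀ X ∈ L, X.IsSingleEdge) : G.IsTidy :=
  (h.isTidy_isSmall fun X hX => ⟨(hL X hX).isTidy, (hL X hX).isSmall⟩).1

lemma IsSeriesJoin.not_linked_deleteEdge {L : List (TwoTerminalGraph α β)} (h : IsSeriesJoin L G)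
    (hL : ∀ X ∈ L, X.IsSingleEdge) (he : e ∈ E(G.graph)) (S : Set α) :
    ¬ (G.deleteEdge e).Linked S := by
  induction h with
  | single G => exact (hL G (by simp)).not_linked_deleteEdge he S
  | @cons A H G L hH h ih =>
    have hA := hL A List.mem_cons_self
    have hL' : ∀ X ∈ L, X.IsSingleEdge := fun X hX => hL X (List.mem_cons_of_mem _ hX)
    have hHp := (hH.isTidy_of_isSingleEdge hL').toIsProper
    rw [(h.deleteEdge e).linked (hA.isProper.deleteEdge e) (hHp.deleteEdge e)]
    rw [h.2.2.2.2.edgeSet] at he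
    rcases he with he | he
    · exact fun hl => hA.not_linked_deleteEdge he S hl.1
    · exact fun hl => ih hL' he hl.2

/-- When an edge of a path of length at least `2` is deleted, the removal of one of the two ends
cuts off a component without terminals. -/
lemma IsPathOfLength.one_le_surplus_deleteEdge {n : ℕ} (h : G.IsPathOfLength n) (hn : 2 ≤ n)
    (he : e ∈ E(G.graph)) :
    1 ≤ (G.deleteEdge e).surplus {G.source} ∨ 1 ≤ (G.deleteEdge e).surplus {G.target} := by
  classical
  obtain ⟨L, hl, hL, h⟩ := h
  cases h with
  | single => simp at hl; omega
  | @cons A H _ L hH h =>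
    have hA := hL A List.mem_cons_self
    have hL' : ∀ X ∈ L, X.IsSingleEdge := fun X hX => hL X (List.mem_cons_of_mem _ hX)
    have hHp := (hH.isTidy_of_isSingleEdge hL').toIsProper
    have hs := h.source_notMem hA.isProper
    have ht := h.target_notMem hHp
    have hsur := (h.deleteEdge e).surplus (hA.isProper.deleteEdge e) (hHp.deleteEdge e)
    have hA0 : ∀ S, 0 ≤ (A.deleteEdge e).surplus S := fun S =>
      (surplus_eq_zero_of_vertexSet_subset (by exact hA.vertexSet.subset)).ge
    rw [h.2.2.2.2.edgeSet] at he
    rw [h.1, h.2.2.1]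
    rcases he with he | he
    · right
      have e1 : 0 ≤ (H.deleteEdge e).surplus {H.target} := surplus_nonneg_of_subset (by simp)
      have e2 := hA0 {H.target}
      rw [hsur, if_neg, if_neg]
      · omega
      · rintro (hl | hl)
        · exact hA.not_linked_deleteEdge he _ hl
        · exact hl.target_notMem rfl
      · rintro hm
        exact ht (hm ▸ hA.isProper.target_mem)
    · left
      have e1 : 0 ≤ (H.deleteEdge e).surplus {A.source} := by
        rw [surplus_eq_of_avoids]
        · exact surplus_nonneg_of_subset (by simp)
        · rintro x hx rfl
          exact hs hx
      have e2 := hA0 {A.source}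
      rw [hsur, if_neg, if_neg]
      · omega
      · rintro (hl | hl)
        · exact hl.source_notMem rfl
        · exact hH.not_linked_deleteEdge hL' he _ hl
      · rintro hm
        exact hA.isProper.ne.symm hm

lemma IsPearl.one_le_surplus_deleteEdge (h : G.IsPearl) (he : e ∈ E(G.graph)) :
    1 ≤ (G.deleteEdge e).surplus {G.source} ∨ 1 ≤ (G.deleteEdge e).surplus {G.target} := by
  obtain ⟨P, Q, m, n, hm, hn, hP, hQ, h⟩ := h
  wlog heP : e ∈ E(P.graph) generalizing P Q m n
  · rw [h.2.2.2.2.2.edgeSet] at he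
    exact this Q P n m hn hm hQ hP h.symm (he.resolve_left heP)
  have hPp := hP.isTidy_isSmall.1.toIsProper
  have hQp := hQ.isTidy_isSmall.1.toIsProper
  have heQ : e ∉ E(Q.graph) := fun h' => Set.disjoint_left.1 h.2.2.2.2.2.1 heP h'
  have hd := h.deleteEdge e
  rw [deleteEdge_of_notMem heQ] at hd
  rw [hd.surplus (hPp.deleteEdge e) hQp, hd.surplus (hPp.deleteEdge e) hQp]
  have e1 : 0 ≤ Q.surplus {G.source} := surplus_nonneg_of_subset (by simp [h.2.1])
  have e2 : 0 ≤ Q.surplus {G.target} := surplus_nonneg_of_subset (by simp [h.2.2.2.1])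
  have := hP.one_le_surplus_deleteEdge hm heP
  rw [h.1, h.2.2.1] at this
  omega

/-! ### Critical edges of series joins -/

/-- In `M - e` there is a set of inner vertices that separates the terminals and has surplus at
least `-1`. Both terminals then contribute a component, so the set shows that `e` is critical for `M`. -/
def CutsInside (M : TwoTerminalGraph α β) (e : β) : Prop :=
  ∃ T : Set α, M.source ∉ T ∧ M.target ∉ T ∧ ¬ (M.deleteEdge e).Linked T ∧
    -1 ≤ (M.deleteEdge e).surplus T

/-- In `M - e` there is a set that contains the source, and not the target, and that has positive
surplus. It shows that `e` is critical as soon as something is attached at the source. -/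
def CutsAtSource (M : TwoTerminalGraph α β) (e : β) : Prop :=
  ∃ T : Set α, M.source ∈ T ∧ M.target ∉ T ∧ 1 ≤ (M.deleteEdge e).surplus T

lemma CutsInside.rev (h : M.CutsInside e) : M.rev.CutsInside e := by
  obtain ⟨T, h1, h2, h3, h4⟩ := h
  exact ⟨T, h2, h1, by rwa [deleteEdge_rev, linked_rev], by rwa [deleteEdge_rev, surplus_rev]⟩

lemma IsSingleEdge.cutsInside (h : G.IsSingleEdge) (he : e ∈ E(G.graph)) : G.CutsInside e :=
  ⟨∅, by simp, by simp, h.not_linked_deleteEdge he _,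
    (by norm_num : (-1 : ℤ) ≤ 0).trans (surplus_nonneg_of_subset (by simp))⟩

lemma IsSeriesJoin₂.cutsInside_left (h : IsSeriesJoin₂ A B G) (hA : A.IsProper) (hB : B.IsTidy)
    (he : e ∈ E(A.graph)) (hc : A.CutsInside e) : G.CutsInside e := by
  classical
  obtain ⟨T, h1, h2, h3, h4⟩ := hc
  have heB : e ∉ E(B.graph) := fun h' => Set.disjoint_left.1 h.2.2.2.2.1 he h'
  have hd := h.deleteEdge e
  rw [deleteEdge_of_notMem heB] at hd
  obtain ⟨U, hs, ht, hUA, hUB, hU⟩ := hd.exists_glue (hA.deleteEdge e) hB.toIsProper (T₁ := T)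
    (T₂ := ∅) (by simpa)
  refine ⟨U, by rw [h.1]; exact fun h => h1 (hs.1 h), by rw [h.2.2.1, ht]; simp, ?_, ?_⟩
  · rw [hd.linked (hA.deleteEdge e) hB.toIsProper]
    exact fun hl => h3 ((linked_congr hUA).1 hl.1)
  · rw [hU, hB.surplus_empty, deleteEdge_target, if_neg h2, if_pos (.inr hB.linked)]
    omega

lemma IsSeriesJoin₂.cutsInside_right (h : IsSeriesJoin₂ A B G) (hA : A.IsTidy) (hB : B.IsProper)
    (he : e ∈ E(B.graph)) (hc : B.CutsInside e) : G.CutsInside e :=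
  (h.rev.cutsInside_left hB.rev hA.rev he hc.rev).rev

lemma IsSeriesJoin₂.cutsInside_of_cutsAtSource (h : IsSeriesJoin₂ A B G) (hA : A.IsProper)
    (hB : B.IsProper) (he : e ∈ E(B.graph)) (hc : B.CutsAtSource e) : G.CutsInside e := by
  classical
  obtain ⟨T, h1, h2, h3⟩ := hc
  have heA : e ∉ E(A.graph) := fun h' => Set.disjoint_left.1 h.2.2.2.2.1 h' he
  have hd := h.deleteEdge e
  rw [deleteEdge_of_notMem heA] at hd
  rw [← h.2.1] at h1
  obtain ⟨U, hs, ht, hUA, -, hU⟩ := hd.exists_glue hA (hB.deleteEdge e) (T₁ := {A.target})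
    (T₂ := T) (by simpa)
  have e1 : 0 ≤ A.surplus {A.target} := surplus_nonneg_of_subset (by simp)
  refine ⟨U, ?_, ?_, ?_, ?_⟩
  · rw [h.1, hs]
    exact hA.ne
  · rw [h.2.2.1]
    exact fun h => h2 (ht.1 h)
  · rw [hd.linked hA (hB.deleteEdge e)]
    exact fun hl => hl.1.target_notMem ((hUA _ hA.target_mem).2 rfl)
  · rw [hU, if_pos (Set.mem_singleton _)]
    omega

lemma IsSeriesJoin₂.cutsAtSource (h : IsSeriesJoin₂ A B G) (hA : A.IsProper) (hB : B.IsTidy)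
    (he : e ∈ E(A.graph)) (hc : A.CutsAtSource e) : G.CutsAtSource e := by
  classical
  obtain ⟨T, h1, h2, h3⟩ := hc
  have heB : e ∉ E(B.graph) := fun h' => Set.disjoint_left.1 h.2.2.2.2.1 he h'
  have hd := h.deleteEdge e
  rw [deleteEdge_of_notMem heB] at hd
  obtain ⟨U, hs, ht, -, -, hU⟩ := hd.exists_glue (hA.deleteEdge e) hB.toIsProper (T₁ := T)
    (T₂ := ∅) (by simpa)
  refine ⟨U, by rw [h.1]; exact hs.2 h1, by rw [h.2.2.1, ht]; simp, ?_⟩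
  rw [hU, hB.surplus_empty, deleteEdge_target, if_neg h2, if_pos (.inr hB.linked)]
  omega

lemma CutsInside.exists_isViolation (h : G.CutsInside e) (hG : G.IsProper) :
    ∃ S, (G.graph.deleteEdges {e}).IsViolation S := by
  classical
  obtain ⟨T, h1, h2, h3, h4⟩ := h
  have := excess_of_notMem_of_notMem (hG.deleteEdge e) h1 h2
  rw [if_neg h3] at this
  refine ⟨T, by rw [← deleteEdge_graph, this]; omega, fun hT => ?_⟩
  rw [← deleteEdge_graph, this, surplus_eq_of_avoids (by exact hT)]
  have : 0 ≤ (G.deleteEdge e).surplus ∅ := surplus_nonneg_of_subset (by simp)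
  omega

lemma IsSeriesJoin.exists_of_cons {L : List (TwoTerminalGraph α β)}
    (h : IsSeriesJoin (A :: L) G) (hL : L ≠ []) :
    ∃ H, IsSeriesJoin L H ∧ IsSeriesJoin₂ A H G := by
  cases h with
  | single => contradiction
  | cons h h' => exact ⟨_, h, h'⟩

lemma isTidy_isSmall_of_isSingleEdge_or_isPearl (h : X.IsSingleEdge ∨ X.IsPearl) :
    X.IsTidy ∧ X.IsSmall :=
  h.elim (fun h => ⟨h.isTidy, h.isSmall⟩) IsPearl.isTidy_isSmall

/-- In a series join of edges and pearls that ends with an edge, every edge is critical after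
something is attached at the source. -/
lemma IsSeriesJoin.cutsInside_or_cutsAtSource {L : List (TwoTerminalGraph α β)}
    (hL : ∀ X ∈ L, X.IsSingleEdge ∨ X.IsPearl) (hB : B.IsSingleEdge)
    (h : IsSeriesJoin (L ++ [B]) G) (he : e ∈ E(G.graph)) :
    G.CutsInside e ∨ G.CutsAtSource e := by
  induction L generalizing G with
  | nil =>
    obtain rfl := IsSeriesJoin.eq_of_singleton h
    exact .inl (hB.cutsInside he)
  | cons X L ih =>
    have hL' : ∀ X ∈ L, X.IsSingleEdge ∨ X.IsPearl := fun Y hY => hL Y (List.mem_cons_of_mem _ hY)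
    obtain ⟨H, hH, h⟩ := IsSeriesJoin.exists_of_cons h (by simp)
    have hHt := (hH.isTidy_isSmall fun Y hY => isTidy_isSmall_of_isSingleEdge_or_isPearl (by
      rcases List.mem_append.1 hY with hY | hY
      · exact hL' Y hY
      · rw [List.mem_singleton.1 hY]
        exact .inl hB)).1
    have hX := hL X List.mem_cons_self
    have hXt := (isTidy_isSmall_of_isSingleEdge_or_isPearl hX).1
    rw [h.2.2.2.2.edgeSet] at he
    rcases he with he | he
    · rcases hX with hX | hX
      · exact .inl (h.cutsInside_left hXt.toIsProper hHt he (hX.cutsInside he))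
      · rcases hX.one_le_surplus_deleteEdge he with hs | hs
        · refine .inr (h.cutsAtSource hXt.toIsProper hHt he ⟨{X.source}, rfl, ?_, hs⟩)
          exact hXt.ne.symm
        · refine .inl ?_
          have := (h.rev.cutsInside_of_cutsAtSource hHt.toIsProper.rev hXt.toIsProper.rev he
            ⟨{X.target}, rfl, hXt.ne, by rwa [deleteEdge_rev, surplus_rev]⟩).rev
          exact this
    · left
      rcases ih hL' hH he with hc | hc
      · exact h.cutsInside_right hXt hHt.toIsProper he hc
      · exact h.cutsInside_of_cutsAtSource hXt.toIsProper hHt.toIsProper he hc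

theorem IsSeriesJoin.isMinimallyTough {L : List (TwoTerminalGraph α β)} (hA : A.IsSingleEdge)
    (hB : B.IsSingleEdge) (hL : ∀ X ∈ L, X.IsSingleEdge ∨ X.IsPearl)
    (h : IsSeriesJoin (A :: (L ++ [B])) G) : G.graph.IsMinimallyTough (1 / 2) := by
  classical
  obtain ⟨H, hH, h⟩ := h.exists_of_cons (by simp)
  obtain ⟨hHt, hHs⟩ := hH.isTidy_isSmall fun Y hY => isTidy_isSmall_of_isSingleEdge_or_isPearl (by
    rcases List.mem_append.1 hY with hY | hY
    · exact hL Y hY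
    · rw [List.mem_singleton.1 hY]
      exact .inl hB)
  have hGt := h.isTidy hA.isTidy hHt
  have hGs := h.isSmall hA.isTidy hHt hA.isSmall hHs
  have hne : B.source ≠ B.target := hB.1
  refine (hGs.halfTough hGt.toIsProper).isMinimallyTough hGt.finite hGt.excess_empty.le ?_
    (x := A.target) ?_ ?_
  · intro e he
    rw [h.2.2.2.2.edgeSet] at he
    refine CutsInside.exists_isViolation ?_ hGt.toIsProper
    rcases he with he | he
    · exact h.cutsInside_left hA.isProper hHt he (hA.cutsInside he)
    · rcases IsSeriesJoin.cutsInside_or_cutsAtSource hL hB hH he with hc | hc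
      · exact h.cutsInside_right hA.isTidy hHt.toIsProper he hc
      · exact h.cutsInside_of_cutsAtSource hA.isProper hHt.toIsProper he hc
  · rw [h.2.2.2.2.2.1]
    exact .inl hA.isProper.target_mem
  · have h1 : A.source ≠ A.target := hA.1
    have h2 : H.target ≠ A.target := by rw [h.2.1]; exact hHt.ne.symm
    rw [excess_of_notMem_of_notMem hGt.toIsProper (by rw [h.1]; exact h1)
      (by rw [h.2.2.1]; exact h2), if_neg, h.surplus hA.isProper hHt.toIsProper, hA.surplus,
      if_pos (Set.mem_singleton _)]
    · have e1 : 0 ≤ H.surplus {A.target} := surplus_nonneg_of_subset (by simp [h.2.1])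
      have e2 := hHs.source {A.target} (by simp [h.2.1]) h2
      omega
    · rw [h.linked hA.isProper hHt.toIsProper]
      exact fun hl => hl.1.target_notMem rfl

end TwoTerminalGraph

theorem mainTheorem1 {α β : Type*} (G : TwoTerminalGraph α β) (hG : G.IsSeriesParallel) :
    G.graph.IsMinimallyTough (1 / 2) ↔
      ∃ (A B : TwoTerminalGraph α β) (L : List (TwoTerminalGraph α β)),
        A.IsSingleEdge ∧ B.IsSingleEdge ∧ (∀ X ∈ L, X.IsSingleEdge ∨ X.IsPearl) ∧
          TwoTerminalGraph.IsSeriesJoin (A :: (L ++ [B])) G := by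
  constructor
  · intro h
    obtain ⟨L, h1, h2, h3, h4⟩ := hG.exists_isSeriesJoin
      hG.isProper.isParallelJoin₂_isolatedTerminals hG.isProper.isOuterContext_isolatedTerminals
      (h.halfTough hG.isProper.finite) (h.everyEdgeCritical hG.isProper.finite)
    replace h3 := h3 G.freeSource_isolatedTerminals
    replace h4 := h4 fun T => by
      simp only [TwoTerminalGraph.surplus_rev, TwoTerminalGraph.surplus_isolatedTerminals]
    match L with
    | [] => exact absurd rfl h1.ne_nil
    | A :: L =>
      have hA : A.IsSingleEdge := h3 A rfl
      rcases L.eq_nil_or_concat with rfl | ⟨L, B, rfl⟩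
      · obtain rfl := h1.eq_of_singleton
        exact absurd h hA.not_isMinimallyTough
      · rw [List.concat_eq_append] at h1 h2 h4
        refine ⟨A, B, L, hA, h4 B ?_, fun X hX => h2 X ?_, ?_⟩
        · rw [← List.cons_append, List.getLast?_append]
          simp
        · simp [hX]
        · exact h1
  · rintro ⟨A, B, L, hA, hB, hL, h⟩
    exact TwoTerminalGraph.IsSeriesJoin.isMinimallyTough hA hB hL h
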